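/- For $x\in\mathbb R^2$ and $u\in\mathbb R_+^2=(0,\infty)^2$ let $B(x,u)=\prod_{i=1}^2[x_i-u_i/2,\,x_i+u_i/2]$ be the box with centre $x$ and edge lengths $u_1,u_2$. Let $\gamma_1,\gamma_2\in(1,2)$, and let $F(\mathrm du)=f_1(u_1)f_2(u_2)\,\mathrm du_1\mathrm du_2$ be a probability measure on $\mathbb R_+^2$, where $f_1,f_2\ge 0$ are measurable and $f_i(t)\sim t^{-\gamma_i-1}$ as $t\to\infty$ for $i=1,2$. For every $\rho>0$ let $\lambda_\rho>0$, let $F_\rho$ be the image of $F$ under $u\mapsto\rho u$, and let $N_\rho$ be a Poisson random measure on $\mathbb R^2\times\mathbb R_+^2$ with intensity measure $\lambda_\rho\,\mathrm dx\,F_\rho(\mathrm du)$. For a finite signed measure $\mu$ on $\mathbb R^2$ put $$J_\rho(\mu)=\int\mu(B(x,u))\,N_\rho(\mathrm dx,\mathrm du),\qquad \widetilde J_\rho(\mu)=J_\rho(\mu)-\mathbb E J_\rho(\mu).$$ Let $\mathcal M^{\gamma_1,\gamma_2}$ be the set of finite signed measures $\mu$ on $\mathbb R^2$ for which there are constants $C>0$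 and $\alpha_i$ with $\gamma_i<\alpha_i\le 2$ ($i=1,2$) such that for all $u\in\mathbb R_+^2$ $$\int_{\mathbb R^2}\mu(B(x,u))^2\,\mathrm dx\le C\min(u_1,u_1^{\alpha_1})\min(u_2,u_2^{\alpha_2}).$$ **Theorem (high intensity regime).** Suppose that $\lambda_\rho\rho^{\gamma_1+\gamma_2}\to\infty$ as $\rho\to0$ (so that also $\lambda_\rho\to\infty$). Then, for every $\rho>0$ and every finite signed measure $\mu$, the integral $J_\rho(\mu)$ converges absolutely almost surely and has finite expectation; the integral $$C_Z(\mu,\nu)=\int_{\mathbb R^2\times\mathbb R_+^2}\mu(B(x,u))\,\nu(B(x,u))\,\frac1{u_1^{\gamma_1+1}}\,\frac1{u_2^{\gamma_2+1}}\,\mathrm d(x,u)$$ converges absolutely for all $\mu,\nu\in\mathcal M^{\gamma_1,\gamma_2}$; there is a centred Gaussian random field $Z=(Z(\mu))_{\mu\in\mathcal M^{\gamma_1,\gamma_2}}$ with covariance function $C_Z$ that is linear, i.e. $Z(a\mu+b\nu)=aZ(\mu)+bZ(\nu)$ almost surely; and $$\frac{\widetilde J_\rho(\cdot)}{\sqrt{\lambda_\rho\rho^{\gamma_1+\gamma_2}}}\longrightarrow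 Z(\cdot)\qquad(\rho\to0)$$ in finite-dimensional distributions on $\mathcal M^{\gamma_1,\gamma_2}$, that is, for all $k$ and all $\mu_1,\dots,\mu_k\in\mathcal M^{\gamma_1,\gamma_2}$ the random vectors $\big(\widetilde J_\rho(\mu_i)/\sqrt{\lambda_\rho\rho^{\gamma_1+\gamma_2}}\big)_{i\le k}$ converge in distribution to $(Z(\mu_i))_{i\le k}$. -/

import Mathlib

open MeasureTheory ProbabilityTheory Filter Topology
open scoped ENNReal NNReal

noncomputable section

namespace RandomBoxes

/-- The positive quadrant `(0, ∞)²` of edge lengths. -/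
def posQuadrant : Set (ℝ × ℝ) := Set.Ioi 0 ×ˢ Set.Ioi 0

/-- The (closed) rectangular box in the plane with centre `x` and edge lengths `u.1`, `u.2`. -/
def box (x u : ℝ × ℝ) : Set (ℝ × ℝ) :=
  Set.Icc (x.1 - u.1 / 2) (x.1 + u.1 / 2) ×ˢ Set.Icc (x.2 - u.2 / 2) (x.2 + u.2 / 2)

/-- The measure `F(du) = f₁(u₁) f₂(u₂) du₁ du₂` on the positive quadrant. -/
def edgeLaw (f₁ f₂ : ℝ → ℝ) : Measure (ℝ × ℝ) :=
  (volume.restrict posQuadrant).withDensity fun u => ENNReal.ofReal (f₁ u.1 * f₂ u.2)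

/-- The image of `F` under the scaling `u ↦ ρ u` of the edge lengths. -/
def scaledLaw (F : Measure (ℝ × ℝ)) (ρ : ℝ) : Measure (ℝ × ℝ) :=
  F.map fun u => ρ • u

/-- The intensity measure `lam dx F(du)` on pairs (centre, edge lengths). -/
def intensity (lam : ℝ) (F : Measure (ℝ × ℝ)) : Measure ((ℝ × ℝ) × (ℝ × ℝ)) :=
  ENNReal.ofReal lam • (volume : Measure (ℝ × ℝ)).prod F

/-- `N` is a Poisson random measure with intensity measure `n`, where `n` is σ-finite: `N` is a
random measure, the mass of a set `A` of finite `n`-measure is Poisson distributed with mean `n A`,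
and the masses of disjoint sets are independent. -/
structure IsPoissonRandomMeasure {E Ω : Type*} [MeasurableSpace E] [MeasurableSpace Ω]
    (N : Ω → Measure E) (n : Measure E) (P : Measure Ω) : Prop where
  measurable : Measurable N
  map_eq : ∀ A : Set E, MeasurableSet A → n A ≠ ∞ →
    P.map (fun ω => N ω A) = (poissonMeasure (n A).toNNReal).map (fun k : ℕ => (k : ℝ≥0∞))
  indep : ∀ (k : ℕ) (A : Fin k → Set E), (∀ i, MeasurableSet (A i)) →
    Pairwise (fun i j => Disjoint (A i) (A j)) → iIndepFun (fun i ω => N ω (A i)) P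

/-- The random field `J(μ) = ∫ μ(B(x,u)) N(dx,du)`. A `SignedMeasure` is real-valued, hence has
finite total variation. -/
def J {Ω : Type*} (N : Ω → Measure ((ℝ × ℝ) × (ℝ × ℝ))) (μ : SignedMeasure (ℝ × ℝ)) (ω : Ω) : ℝ :=
  ∫ p, μ (box p.1 p.2) ∂(N ω)

/-- The centred field `J(μ) - 𝔼 J(μ)`. -/
def centredJ {Ω : Type*} [MeasurableSpace Ω] (P : Measure Ω)
    (N : Ω → Measure ((ℝ × ℝ) × (ℝ × ℝ))) (μ : SignedMeasure (ℝ × ℝ)) (ω : Ω) : ℝ :=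
  J N μ ω - ∫ ω', J N μ ω' ∂P

/-- The space of signed measures `μ` on the plane for which there are `C > 0` and
`γᵢ < αᵢ ≤ 2` with
`∫ μ(B(x,u))² dx ≤ C min(u₁, u₁^α₁) min(u₂, u₂^α₂)` for all positive `u₁, u₂`. -/
def admissible (γ₁ γ₂ : ℝ) : Set (SignedMeasure (ℝ × ℝ)) :=
  {μ | ∃ C α₁ α₂ : ℝ, 0 < C ∧ γ₁ < α₁ ∧ α₁ ≤ 2 ∧ γ₂ < α₂ ∧ α₂ ≤ 2 ∧
    ∀ u ∈ posQuadrant,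
      ∫⁻ x, ENNReal.ofReal (μ (box x u) ^ 2) ≤
        ENNReal.ofReal (C * min u.1 (u.1 ^ α₁) * min u.2 (u.2 ^ α₂))}

/-- The integrand of the limiting covariance, a function of `p = (x, u)`. -/
def covIntegrand (γ₁ γ₂ : ℝ) (μ ν : SignedMeasure (ℝ × ℝ)) (p : (ℝ × ℝ) × (ℝ × ℝ)) : ℝ :=
  μ (box p.1 p.2) * ν (box p.1 p.2) * (1 / p.2.1 ^ (γ₁ + 1)) * (1 / p.2.2 ^ (γ₂ + 1))

/-- `Z` is a centred Gaussian linear random field indexed by the set `M` of signed measures, with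
covariance function `K`. -/
structure IsCentredGaussianLinearField {Ω : Type*} [MeasurableSpace Ω] (P : Measure Ω)
    (M : Set (SignedMeasure (ℝ × ℝ)))
    (K : SignedMeasure (ℝ × ℝ) → SignedMeasure (ℝ × ℝ) → ℝ) (Z : M → Ω → ℝ) : Prop where
  gaussian : IsGaussianProcess Z P
  centred : ∀ μ : M, ∫ ω, Z μ ω ∂P = 0
  covariance_eq : ∀ μ ν : M, cov[Z μ, Z ν; P] = K μ ν
  linear : ∀ (a b : ℝ) (μ ν κ : M),
    (κ : SignedMeasure (ℝ × ℝ)) = a • (μ : SignedMeasure (ℝ × ℝ)) + b • (ν : SignedMeasure (ℝ × ℝ)) →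
      ∀ᵐ ω ∂P, Z κ ω = a * Z μ ω + b * Z ν ω

end RandomBoxes

end

namespace RandomBoxes

/-! ### Poisson integrals: Campbell's formula and characteristic functions -/

/-! The proof is a central limit theorem by characteristic functions. Write σ = λ_ρ ρ^(γ₁+γ₂). Since
J is linear in the measure, Σ tⱼ J̃_ρ(μⱼ) is almost surely J̃_ρ(κ) for κ = Σ tⱼ μⱼ, and κ is again
admissible (`sum_smul_mem_admissible`). By Lévy's continuity theorem it is therefore enough to find
the limit of E exp(i J̃_ρ(κ)/√σ) for a single admissible κ.

For a Poisson integral this expectation is explicit: E exp(i(∫g dN − E∫g dN)) = exp ∫(e^{ig} − 1 −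
ig) dn (`IsPoissonRandomMeasure.integral_cexp_centred`). The formula without centring comes from
independence and the Poisson law for simple g, then from L¹-continuity; Campbell's formula supplies
the centring. The intensity equals σ times the product of the normalized densities ρ^(-γᵢ-1)
fᵢ(uᵢ/ρ) (`intensity_eq_withDensity`), and these tend pointwise to uᵢ^(-γᵢ-1). With g = y/√σ and y =
κ(B(x,u)), the factor σ(e^{ig} − 1 − ig) tends to −y²/2 and is bounded by 2y² uniformly in σ.
Formally the exponent thus tends to −C_Z(κ,κ)/2.

To justify the passage to the limit, note that the tail asymptotics control the normalized densities
only for edges of length at least ρT. Where both edges are that long, dominated convergence applies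
(`tendsto_integral_largeEdges`). The remaining boxes are negligible: admissibility with αᵢ > γᵢ
gives a factor ρ^(αᵢ-γᵢ) for each short edge (`tendsto_integral_compl_largeEdges`). The dominating
function is integrable because αᵢ > γᵢ near zero and γᵢ > 1 at infinity
(`lintegral_min_rpow_ne_top`).

The limiting field is an isonormal Gaussian process on L² evaluated at the functions `covFeature`,
whose inner products are C_Z; linearity comes with the construction. -/

/-- The mean of the Poisson distribution, as an extended nonnegative number. -/
lemma lintegral_natCast_poissonMeasure (r : ℝ≥0) :
    ∫⁻ k : ℕ, (k : ℝ≥0∞) ∂(poissonMeasure r) = r := by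
  have hs : HasSum (fun k : ℕ => Real.exp (-r) * r ^ k / (k.factorial : ℝ) * k) (r : ℝ) := by
    have h1 := (hasSum_one_poissonMeasure r).mul_left (r : ℝ)
    rw [mul_one] at h1
    -- The term k = 0 vanishes; after the shift k · rᵏ/k! becomes r · rᵏ/k!, which sums to r times
    -- the total mass.
    rw [← hasSum_nat_add_iff' 1]
    simp only [Finset.range_one, Finset.sum_singleton, Nat.cast_zero, mul_zero, sub_zero]
    refine h1.congr_fun ?_
    intro k
    have : ((k.factorial : ℕ) : ℝ) ≠ 0 := by positivity
    have h2 : ((k : ℝ) + 1) ≠ 0 := by positivity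
    rw [Nat.factorial_succ]
    push_cast
    field_simp
    ring
  rw [poissonMeasure, lintegral_sum_measure]
  simp_rw [lintegral_smul_measure, lintegral_dirac, smul_eq_mul]
  have h3 : ∀ k : ℕ, ENNReal.ofReal (Real.exp (-r) * r ^ k / (k.factorial : ℝ)) * (k : ℝ≥0∞)
      = ENNReal.ofReal (Real.exp (-r) * r ^ k / (k.factorial : ℝ) * k) := by
    intro k
    rw [ENNReal.ofReal_mul (by positivity), ENNReal.ofReal_natCast]
  simp_rw [h3]
  rw [← ENNReal.ofReal_tsum_of_nonneg (fun k => by positivity) hs.summable, hs.tsum_eq,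
    ENNReal.ofReal_coe_nnreal]

section Poisson

variable {E Ω : Type*} [MeasurableSpace E] [MeasurableSpace Ω] {N : Ω → Measure E} {n : Measure E}
  {P : Measure Ω}

lemma IsPoissonRandomMeasure.measurable_apply (hN : IsPoissonRandomMeasure N n P) {A : Set E}
    (hA : MeasurableSet A) : Measurable fun ω => N ω A :=
  (Measure.measurable_coe hA).comp hN.measurable

lemma IsPoissonRandomMeasure.lintegral_apply_of_ne_top (hN : IsPoissonRandomMeasure N n P)
    {A : Set E} (hA : MeasurableSet A) (hnA : n A ≠ ∞) : ∫⁻ ω, N ω A ∂P = n A := by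
  have h1 : ∫⁻ ω, N ω A ∂P = ∫⁻ x, x ∂(P.map fun ω => N ω A) :=
    (lintegral_map measurable_id (hN.measurable_apply hA)).symm
  rw [h1, hN.map_eq A hA hnA, lintegral_map (f := fun x => x) measurable_id (by fun_prop)]
  simp only [lintegral_natCast_poissonMeasure, ENNReal.coe_toNNReal hnA]

/-- The Poisson law is prescribed only on sets of finite mass, so a general set is cut into
countably many disjoint pieces of finite mass and the means are added. -/
lemma IsPoissonRandomMeasure.bind_eq [SigmaFinite n] (hN : IsPoissonRandomMeasure N n P) :
    P.bind N = n := by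
  ext A hA
  rw [Measure.bind_apply hA hN.measurable.aemeasurable]
  have hU : A = ⋃ k, A ∩ disjointed (spanningSets n) k := by
    rw [← Set.inter_iUnion, iUnion_disjointed, iUnion_spanningSets, Set.inter_univ]
  have hd : Pairwise (Function.onFun Disjoint fun k => A ∩ disjointed (spanningSets n) k) :=
    fun i j hij => ((disjoint_disjointed (spanningSets n)) hij).mono
      Set.inter_subset_right Set.inter_subset_right
  have hm : ∀ k, MeasurableSet (A ∩ disjointed (spanningSets n) k) := fun k =>
    hA.inter (MeasurableSet.disjointed (measurableSet_spanningSets n) k)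
  have hfin : ∀ k, n (A ∩ disjointed (spanningSets n) k) ≠ ∞ := fun k =>
    ((measure_mono (Set.inter_subset_right.trans (disjointed_subset _ _))).trans_lt
      (measure_spanningSets_lt_top n k)).ne
  have h1 : ∀ ν : Measure E, ν A = ∑' k, ν (A ∩ disjointed (spanningSets n) k) := fun ν => by
    conv_lhs => rw [hU]
    exact measure_iUnion hd hm
  simp_rw [h1]
  rw [lintegral_tsum fun k => (hN.measurable_apply (hm k)).aemeasurable]
  exact tsum_congr fun k => hN.lintegral_apply_of_ne_top (hm k) (hfin k)

/-- **Campbell's formula** for nonnegative integrands. -/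
lemma IsPoissonRandomMeasure.lintegral_lintegral [SigmaFinite n]
    (hN : IsPoissonRandomMeasure N n P) {g : E → ℝ≥0∞} (hg : Measurable g) :
    ∫⁻ ω, ∫⁻ x, g x ∂(N ω) ∂P = ∫⁻ x, g x ∂n := by
  conv_rhs => rw [← hN.bind_eq]
  exact (Measure.lintegral_bind hN.measurable.aemeasurable hg.aemeasurable).symm

lemma IsPoissonRandomMeasure.measurable_lintegral
    (hN : IsPoissonRandomMeasure N n P) {g : E → ℝ≥0∞} (hg : Measurable g) :
    Measurable fun ω => ∫⁻ x, g x ∂(N ω) :=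
  (Measure.measurable_lintegral hg).comp hN.measurable

lemma IsPoissonRandomMeasure.ae_integrable [SigmaFinite n]
    (hN : IsPoissonRandomMeasure N n P) {g : E → ℝ} (hg : Measurable g) (hgi : Integrable g n) :
    ∀ᵐ ω ∂P, Integrable g (N ω) := by
  have h := hN.lintegral_lintegral (g := fun x => ‖g x‖ₑ) hg.enorm
  have := ae_lt_top (hN.measurable_lintegral (g := fun x => ‖g x‖ₑ) hg.enorm)
    (by rw [h]; exact hgi.2.ne)
  filter_upwards [this] with ω hω
  exact ⟨hg.aestronglyMeasurable, hω⟩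

/-- The Bochner integral has no evident measurability in the measure. The difference of the
integrals of positive and negative part does, and the two agree wherever g is integrable, hence
almost surely. -/
lemma IsPoissonRandomMeasure.aestronglyMeasurable_integral [SigmaFinite n]
    (hN : IsPoissonRandomMeasure N n P) {g : E → ℝ} (hg : Measurable g) (hgi : Integrable g n) :
    AEStronglyMeasurable (fun ω => ∫ x, g x ∂(N ω)) P := by
  have hm : Measurable fun ω => (∫⁻ x, ENNReal.ofReal (g x) ∂(N ω)).toReal -
      (∫⁻ x, ENNReal.ofReal (-g x) ∂(N ω)).toReal :=
    (hN.measurable_lintegral hg.ennreal_ofReal).ennreal_toReal.sub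
      (hN.measurable_lintegral hg.neg.ennreal_ofReal).ennreal_toReal
  refine hm.aestronglyMeasurable.congr ?_
  filter_upwards [hN.ae_integrable hg hgi] with ω hω
  exact (integral_eq_lintegral_pos_part_sub_lintegral_neg_part hω).symm

/-- The map g ↦ ∫ g dN is a contraction from L¹(n) to L¹(P); this carries identities from simple
functions to integrable ones. -/
lemma IsPoissonRandomMeasure.lintegral_enorm_integral_le [SigmaFinite n]
    (hN : IsPoissonRandomMeasure N n P) {g : E → ℝ} (hg : Measurable g) :
    ∫⁻ ω, ‖∫ x, g x ∂(N ω)‖ₑ ∂P ≤ ∫⁻ x, ‖g x‖ₑ ∂n := by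
  rw [← hN.lintegral_lintegral (g := fun x => ‖g x‖ₑ) hg.enorm]
  exact lintegral_mono fun ω => enorm_integral_le_lintegral_enorm _

lemma IsPoissonRandomMeasure.integrable_integral [SigmaFinite n]
    (hN : IsPoissonRandomMeasure N n P) {g : E → ℝ} (hg : Measurable g) (hgi : Integrable g n) :
    Integrable (fun ω => ∫ x, g x ∂(N ω)) P :=
  ⟨hN.aestronglyMeasurable_integral hg hgi,
    (hN.lintegral_enorm_integral_le hg).trans_lt hgi.2⟩

/-- **Campbell's formula** for integrable integrands. -/
lemma IsPoissonRandomMeasure.integral_integral [SigmaFinite n]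
    (hN : IsPoissonRandomMeasure N n P) {g : E → ℝ} (hg : Measurable g) (hgi : Integrable g n) :
    ∫ ω, ∫ x, g x ∂(N ω) ∂P = ∫ x, g x ∂n := by
  have hlt : ∀ h : E → ℝ, Measurable h → Integrable h n →
      Integrable (fun ω => (∫⁻ x, ENNReal.ofReal (h x) ∂(N ω)).toReal) P ∧
      ∫ ω, (∫⁻ x, ENNReal.ofReal (h x) ∂(N ω)).toReal ∂P
        = (∫⁻ x, ENNReal.ofReal (h x) ∂n).toReal := by
    intro h hh hhi
    have hfin : ∫⁻ ω, ∫⁻ x, ENNReal.ofReal (h x) ∂(N ω) ∂P ≠ ∞ := by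
      rw [hN.lintegral_lintegral hh.ennreal_ofReal]
      exact hhi.lintegral_lt_top.ne
    have hmm := hN.measurable_lintegral hh.ennreal_ofReal
    refine ⟨integrable_toReal_of_lintegral_ne_top hmm.aemeasurable hfin, ?_⟩
    rw [integral_toReal hmm.aemeasurable (ae_lt_top hmm hfin),
      hN.lintegral_lintegral hh.ennreal_ofReal]
  have h1 := hlt g hg hgi
  have h2 := hlt (fun x => -g x) hg.neg hgi.neg
  rw [integral_eq_lintegral_pos_part_sub_lintegral_neg_part hgi, ← h1.2, ← h2.2,
    ← integral_sub h1.1 h2.1]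
  refine integral_congr_ae ?_
  filter_upwards [hN.ae_integrable hg hgi] with ω hω
  exact integral_eq_lintegral_pos_part_sub_lintegral_neg_part hω

lemma norm_cexp_mul_I_sub_le (x y : ℝ) :
    ‖Complex.exp (x * Complex.I) - Complex.exp (y * Complex.I)‖ ≤ |x - y| := by
  have h : Complex.exp (x * Complex.I) - Complex.exp (y * Complex.I) =
      Complex.exp (y * Complex.I) * (Complex.exp (Complex.I * ((x - y : ℝ) : ℂ)) - 1) := by
    rw [mul_sub, ← Complex.exp_add, mul_one]
    congr 2
    push_cast
    ring
  rw [h, norm_mul, Complex.norm_exp_ofReal_mul_I, one_mul]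
  exact Real.norm_exp_I_mul_ofReal_sub_one_le

lemma IsPoissonRandomMeasure.integral_cexp_mul_toReal [IsProbabilityMeasure P]
    (hN : IsPoissonRandomMeasure N n P)
    {A : Set E} (hA : MeasurableSet A) (hnA : n A ≠ ∞) (c : ℝ) :
    ∫ ω, Complex.exp (((N ω A).toReal * c : ℝ) * Complex.I) ∂P
      = Complex.exp ((n A).toReal * (Complex.exp (c * Complex.I) - 1)) := by
  have h1 : ∫ ω, Complex.exp (((N ω A).toReal * c : ℝ) * Complex.I) ∂P
      = ∫ x, Complex.exp ((x.toReal * c : ℝ) * Complex.I) ∂(P.map fun ω => N ω A) := by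
    rw [integral_map (hN.measurable_apply hA).aemeasurable]
    exact Measurable.aestronglyMeasurable (by fun_prop)
  rw [h1, hN.map_eq A hA hnA, integral_map (by fun_prop)
    (Measurable.aestronglyMeasurable (by fun_prop))]
  have h2 := charFun_map_cast_poissonMeasure (n A).toNNReal c
  rw [charFun_apply, integral_map .of_discrete (by fun_prop)] at h2
  have h3 : (((n A).toNNReal : ℝ) : ℂ) = ((n A).toReal : ℂ) := rfl
  rw [← h3]
  simpa [mul_comm] using h2

/-- The characteristic functional of a Poisson random measure at a simple function. -/
lemma IsPoissonRandomMeasure.integral_cexp_simpleFunc [SigmaFinite n] [IsProbabilityMeasure P]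
    (hN : IsPoissonRandomMeasure N n P) (s : SimpleFunc E ℝ) (hs : Integrable s n) :
    ∫ ω, Complex.exp ((∫ x, s x ∂(N ω) : ℝ) * Complex.I) ∂P
      = Complex.exp (∫ x, (Complex.exp (s x * Complex.I) - 1) ∂n) := by
  classical
  -- The value 0 is discarded: its level set may have infinite n-mass, and it contributes to neither
  -- side. The other level sets are disjoint and of finite mass, so their masses are independent
  -- Poisson variables.
  set T : Finset ℝ := {x ∈ s.range | x ≠ 0} with hT
  set e := T.equivFin
  have hTm : ∀ c : T, (c : ℝ) ≠ 0 := fun c => (Finset.mem_filter.1 c.2).2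
  have hind : iIndepFun (fun (c : T) ω => N ω (s ⁻¹' {(c : ℝ)})) P := by
    have h := hN.indep T.card (fun i => s ⁻¹' {((e.symm i : T) : ℝ)})
      (fun i => s.measurableSet_preimage _) (fun i j hij => by
        refine Disjoint.preimage _ ?_
        simp only [Set.disjoint_singleton]
        exact fun h => hij (e.symm.injective (Subtype.ext h)))
    have h' := h.precomp e.injective
    simpa using h'
  have h1 : ∀ᵐ ω ∂P, Complex.exp ((∫ x, s x ∂(N ω) : ℝ) * Complex.I)
      = ∏ c : T, Complex.exp (((N ω (s ⁻¹' {(c : ℝ)})).toReal * c : ℝ) * Complex.I) := by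
    filter_upwards [hN.ae_integrable s.measurable hs] with ω hω
    rw [← s.integral_eq_integral hω, SimpleFunc.integral_eq_sum_filter, ← Complex.exp_sum,
      ← Finset.sum_mul, ← Complex.ofReal_sum, ← hT, ← Finset.sum_coe_sort]
    simp only [smul_eq_mul, measureReal_def]
  rw [integral_congr_ae h1]
  have h2 := hind.integral_fun_prod_comp (𝕜 := ℂ)
    (f := fun (c : T) (x : ℝ≥0∞) => Complex.exp ((x.toReal * (c : ℝ) : ℝ) * Complex.I))
    (fun c => (hN.measurable_apply (s.measurableSet_preimage _)).aemeasurable)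
    (fun c => Measurable.aestronglyMeasurable (by fun_prop))
  rw [h2]
  have h3 : ∀ c : T, n (s ⁻¹' {(c : ℝ)}) ≠ ∞ := fun c =>
    (SimpleFunc.integrable_iff.1 hs c (hTm c)).ne
  simp_rw [fun c : T => hN.integral_cexp_mul_toReal (s.measurableSet_preimage {(c : ℝ)}) (h3 c) c]
  rw [← Complex.exp_sum]
  congr 1
  set G : ℝ → ℂ := fun x => Complex.exp (x * Complex.I) - 1 with hG
  have hG0 : G 0 = 0 := by simp [hG]
  have hi : Integrable (s.map G) n := by
    rw [SimpleFunc.integrable_iff_finMeasSupp] at hs ⊢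
    exact hs.map hG0
  have h4 := (s.map G).integral_eq_integral hi
  rw [SimpleFunc.map_integral s G hs hG0] at h4
  change _ = ∫ x, G (s x) ∂n
  refine Eq.trans ?_ h4
  rw [Finset.sum_coe_sort T (fun c => ((n (s ⁻¹' {c})).toReal : ℂ) * G c), hT,
    Finset.sum_filter_of_ne]
  · simp [measureReal_def]
  · rintro x - hx rfl
    exact hx (by rw [hG0, mul_zero])

/-- The characteristic functional of a Poisson random measure. -/
theorem IsPoissonRandomMeasure.integral_cexp_integral [SigmaFinite n] [IsProbabilityMeasure P]
    (hN : IsPoissonRandomMeasure N n P) {g : E → ℝ} (hg : Measurable g) (hgi : Integrable g n) :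
    ∫ ω, Complex.exp ((∫ x, g x ∂(N ω) : ℝ) * Complex.I) ∂P
      = Complex.exp (∫ x, (Complex.exp (g x * Complex.I) - 1) ∂n) := by
  -- Both sides are continuous along L¹(n)-convergence, because t ↦ e^{it} is 1-Lipschitz, so simple
  -- approximations suffice.
  set s : ℕ → SimpleFunc E ℝ := SimpleFunc.approxOn g hg (Set.range g ∪ {0}) 0 (by simp) with hs
  have hsi : ∀ k, Integrable (s k) n := SimpleFunc.integrable_approxOn_range hg hgi
  have hlim : Tendsto (fun k => ∫⁻ x, ‖s k x - g x‖ₑ ∂n) atTop (𝓝 0) :=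
    SimpleFunc.tendsto_approxOn_range_L1_enorm hg hgi
  have hexpi : ∀ h : E → ℝ, Measurable h → Integrable h n →
      Integrable (fun x => Complex.exp (h x * Complex.I) - 1) n := by
    intro h hh hhi
    refine hhi.mono (Measurable.aestronglyMeasurable (by fun_prop)) (Eventually.of_forall fun x => ?_)
    simpa using norm_cexp_mul_I_sub_le (h x) 0
  have hcexpi : ∀ h : E → ℝ, Measurable h → Integrable h n →
      Integrable (fun ω => Complex.exp ((∫ x, h x ∂(N ω) : ℝ) * Complex.I)) P := by
    intro h hh hhi
    refine (integrable_const (1 : ℝ)).mono ?_ (Eventually.of_forall fun ω => ?_)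
    · have := hN.aestronglyMeasurable_integral hh hhi
      fun_prop
    · simp [Complex.norm_exp_ofReal_mul_I]
  have hL : Tendsto (fun k => ∫ ω, Complex.exp ((∫ x, s k x ∂(N ω) : ℝ) * Complex.I) ∂P) atTop
      (𝓝 (∫ ω, Complex.exp ((∫ x, g x ∂(N ω) : ℝ) * Complex.I) ∂P)) := by
    refine tendsto_integral_of_L1 _ (hcexpi g hg hgi).aestronglyMeasurable
      (Eventually.of_forall fun k => hcexpi _ (s k).measurable (hsi k)) ?_
    refine tendsto_of_tendsto_of_tendsto_of_le_of_le tendsto_const_nhds hlim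
      (fun _ => zero_le) fun k => ?_
    refine le_trans (lintegral_mono_ae ?_)
      (hN.lintegral_enorm_integral_le ((s k).measurable.sub hg))
    filter_upwards [hN.ae_integrable (s k).measurable (hsi k), hN.ae_integrable hg hgi]
      with ω h1 h2
    rw [← ofReal_norm, ← ofReal_norm]
    refine ENNReal.ofReal_le_ofReal ((norm_cexp_mul_I_sub_le _ _).trans (le_of_eq ?_))
    rw [integral_sub h1 h2, Real.norm_eq_abs]
  have hR : Tendsto (fun k => ∫ x, (Complex.exp (s k x * Complex.I) - 1) ∂n) atTop
      (𝓝 (∫ x, (Complex.exp (g x * Complex.I) - 1) ∂n)) := by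
    refine tendsto_integral_of_L1 _ (hexpi g hg hgi).aestronglyMeasurable
      (Eventually.of_forall fun k => hexpi _ (s k).measurable (hsi k)) ?_
    refine tendsto_of_tendsto_of_tendsto_of_le_of_le tendsto_const_nhds hlim
      (fun _ => zero_le) fun k => lintegral_mono fun x => ?_
    rw [← ofReal_norm, ← ofReal_norm]
    refine ENNReal.ofReal_le_ofReal ?_
    rw [sub_sub_sub_cancel_right]
    exact norm_cexp_mul_I_sub_le _ _
  refine tendsto_nhds_unique hL ?_
  simp_rw [fun k => hN.integral_cexp_simpleFunc (s k) (hsi k)]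
  exact (Complex.continuous_exp.tendsto _).comp hR

/-- The characteristic function of a centred Poisson integral. -/
theorem IsPoissonRandomMeasure.integral_cexp_centred [SigmaFinite n] [IsProbabilityMeasure P]
    (hN : IsPoissonRandomMeasure N n P) {g : E → ℝ} (hg : Measurable g) (hgi : Integrable g n) :
    ∫ ω, Complex.exp (((∫ x, g x ∂(N ω)) - ∫ ω', ∫ x, g x ∂(N ω') ∂P : ℝ) * Complex.I) ∂P
      = Complex.exp (∫ x, (Complex.exp (g x * Complex.I) - 1 - g x * Complex.I) ∂n) := by
  have hexpi : Integrable (fun x => Complex.exp (g x * Complex.I) - 1) n := by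
    refine hgi.mono (Measurable.aestronglyMeasurable (by fun_prop)) (Eventually.of_forall fun x => ?_)
    simpa using norm_cexp_mul_I_sub_le (g x) 0
  have hgI : Integrable (fun x => (g x : ℂ) * Complex.I) n := hgi.ofReal.mul_const _
  have hgr : ∫ x, (g x : ℂ) ∂n = ((∫ x, g x ∂n : ℝ) : ℂ) := integral_ofReal
  rw [integral_sub hexpi hgI, integral_mul_const, hgr,
    Complex.exp_sub, ← hN.integral_cexp_integral hg hgi, hN.integral_integral hg hgi,
    div_eq_mul_inv, ← Complex.exp_neg, ← integral_mul_const]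
  congr 1
  ext ω
  rw [← Complex.exp_add]
  congr 1
  push_cast
  ring

end Poisson

end RandomBoxes

namespace RandomBoxes

/-! ### One-dimensional edge densities and their scaling -/

/-- The density `f` of an edge length, scaled by `ρ` and normalized by `ρ ^ (-γ)`. -/
noncomputable def scaledDensity (γ : ℝ) (f : ℝ → ℝ) (ρ t : ℝ) : ℝ := ρ ^ (-γ) * (ρ⁻¹ * f (t / ρ))

lemma measurable_scaledDensity {γ : ℝ} {f : ℝ → ℝ} (hf : Measurable f) (ρ : ℝ) :
    Measurable (scaledDensity γ f ρ) := by
  unfold scaledDensity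
  fun_prop

lemma scaledDensity_nonneg {γ : ℝ} {f : ℝ → ℝ} (hf : ∀ t, 0 < t → 0 ≤ f t) {ρ t : ℝ}
    (hρ : 0 < ρ) (ht : 0 < t) : 0 ≤ scaledDensity γ f ρ t := by
  have := hf (t / ρ) (by positivity)
  unfold scaledDensity
  positivity

lemma lintegral_Ioi_comp_mul {ρ : ℝ} (hρ : 0 < ρ) {k : ℝ → ℝ≥0∞} (hk : Measurable k) :
    ∫⁻ t in Set.Ioi 0, k (ρ * t) = ENNReal.ofReal ρ⁻¹ * ∫⁻ t in Set.Ioi 0, k t := by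
  have h1 : ∀ t : ℝ, (Set.Ioi (0 : ℝ)).indicator (fun t => k (ρ * t)) t
      = (Set.Ioi (0 : ℝ)).indicator k (ρ * t) := by
    intro t
    by_cases ht : 0 < t
    · rw [Set.indicator_of_mem (Set.mem_Ioi.2 ht),
        Set.indicator_of_mem (Set.mem_Ioi.2 (mul_pos hρ ht))]
    · rw [Set.indicator_of_notMem (by simpa using ht), Set.indicator_of_notMem]
      simp only [Set.mem_Ioi, not_lt]
      exact mul_nonpos_of_nonneg_of_nonpos hρ.le (not_lt.1 ht)
  rw [← lintegral_indicator measurableSet_Ioi, ← lintegral_indicator measurableSet_Ioi]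
  simp_rw [h1]
  rw [← lintegral_map (f := (Set.Ioi (0 : ℝ)).indicator k) (hk.indicator measurableSet_Ioi)
    (measurable_const_mul ρ), Real.map_volume_mul_left hρ.ne', lintegral_smul_measure,
    abs_of_pos (inv_pos.2 hρ), smul_eq_mul]

lemma lintegral_scaledDensity (γ : ℝ) {f : ℝ → ℝ} (hf : Measurable f) {ρ : ℝ} (hρ : 0 < ρ) :
    ∫⁻ t in Set.Ioi 0, ENNReal.ofReal (scaledDensity γ f ρ t)
      = ENNReal.ofReal (ρ ^ (-γ)) * ∫⁻ t in Set.Ioi 0, ENNReal.ofReal (f t) := by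
  have h := lintegral_Ioi_comp_mul (inv_pos.2 hρ) (k := fun t => ENNReal.ofReal (f t))
    hf.ennreal_ofReal
  unfold scaledDensity
  simp_rw [ENNReal.ofReal_mul (Real.rpow_nonneg hρ.le (-γ)), ENNReal.ofReal_mul (inv_pos.2 hρ).le,
    div_eq_inv_mul]
  rw [lintegral_const_mul _ (by fun_prop), lintegral_const_mul _ (by fun_prop), h, inv_inv,
    ← mul_assoc (ENNReal.ofReal ρ⁻¹), ← ENNReal.ofReal_mul (inv_pos.2 hρ).le,
    inv_mul_cancel₀ hρ.ne', ENNReal.ofReal_one, one_mul]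

lemma map_mul_withDensity {f : ℝ → ℝ} (hf : Measurable f) {ρ : ℝ} (hρ : 0 < ρ) :
    ((volume.restrict (Set.Ioi 0)).withDensity fun t => ENNReal.ofReal (f t)).map (fun t => ρ * t)
      = (volume.restrict (Set.Ioi 0)).withDensity
          fun t => ENNReal.ofReal (ρ⁻¹ * f (t / ρ)) := by
  ext A hA
  have hm : Measurable fun t : ℝ => ρ * t := measurable_const_mul ρ
  rw [Measure.map_apply hm hA, withDensity_apply _ (hm hA), withDensity_apply _ hA,
    ← lintegral_indicator (hm hA), ← lintegral_indicator hA]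
  have h := lintegral_Ioi_comp_mul hρ
    (k := A.indicator fun t => ENNReal.ofReal (f (t / ρ)))
    (Measurable.indicator (by fun_prop) hA)
  rw [← lintegral_const_mul _ (Measurable.indicator (by fun_prop) hA)] at h
  convert! h using 2
  · ext t
    by_cases ht : ρ * t ∈ A
    · rw [Set.indicator_of_mem ht, Set.indicator_of_mem (show t ∈ (fun t => ρ * t) ⁻¹' A from ht),
        mul_div_cancel_left₀ _ hρ.ne']
    · rw [Set.indicator_of_notMem ht,
        Set.indicator_of_notMem (show t ∉ (fun t => ρ * t) ⁻¹' A from ht)]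
  · ext t
    by_cases ht : t ∈ A
    · rw [Set.indicator_of_mem ht, Set.indicator_of_mem ht, ENNReal.ofReal_mul (inv_pos.2 hρ).le]
    · rw [Set.indicator_of_notMem ht, Set.indicator_of_notMem ht, mul_zero]

/-! ### Edge law and intensity as densities with respect to Lebesgue measure. -/

lemma volume_restrict_posQuadrant :
    (volume : Measure (ℝ × ℝ)).restrict posQuadrant
      = (volume.restrict (Set.Ioi 0)).prod (volume.restrict (Set.Ioi 0)) := by
  rw [posQuadrant, Measure.prod_restrict, ← Measure.volume_eq_prod]

lemma measurableSet_posQuadrant : MeasurableSet posQuadrant :=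
  measurableSet_Ioi.prod measurableSet_Ioi

lemma edgeLaw_eq_prod {f₁ f₂ : ℝ → ℝ} (hf₁ : Measurable f₁) (hf₂ : Measurable f₂)
    (h₁ : ∀ t, 0 < t → 0 ≤ f₁ t) :
    edgeLaw f₁ f₂ = ((volume.restrict (Set.Ioi 0)).withDensity fun t => ENNReal.ofReal (f₁ t)).prod
      ((volume.restrict (Set.Ioi 0)).withDensity fun t => ENNReal.ofReal (f₂ t)) := by
  rw [prod_withDensity hf₁.ennreal_ofReal hf₂.ennreal_ofReal, ← volume_restrict_posQuadrant,
    edgeLaw]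
  refine withDensity_congr_ae ?_
  filter_upwards [ae_restrict_mem measurableSet_posQuadrant] with u hu
  exact ENNReal.ofReal_mul (h₁ _ hu.1)

lemma scaledLaw_edgeLaw {f₁ f₂ : ℝ → ℝ} (hf₁ : Measurable f₁) (hf₂ : Measurable f₂)
    (h₁ : ∀ t, 0 < t → 0 ≤ f₁ t) {ρ : ℝ} (hρ : 0 < ρ) :
    scaledLaw (edgeLaw f₁ f₂) ρ = (volume.restrict posQuadrant).withDensity fun u =>
      ENNReal.ofReal (ρ⁻¹ * f₁ (u.1 / ρ)) * ENNReal.ofReal (ρ⁻¹ * f₂ (u.2 / ρ)) := by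
  have h : (fun u : ℝ × ℝ => ρ • u) = Prod.map (fun t => ρ * t) (fun t => ρ * t) := by
    ext u <;> simp
  rw [scaledLaw, edgeLaw_eq_prod hf₁ hf₂ h₁, h, ← Measure.map_prod_map _ _ (measurable_const_mul ρ)
    (measurable_const_mul ρ), map_mul_withDensity hf₁ hρ, map_mul_withDensity hf₂ hρ,
    prod_withDensity (by fun_prop) (by fun_prop), volume_restrict_posQuadrant]

/-- Lebesgue measure on pairs (centre, edge lengths). -/
noncomputable def refMeasure : Measure ((ℝ × ℝ) × (ℝ × ℝ)) := volume.restrict (Set.univ ×ˢ posQuadrant)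

lemma refMeasure_eq_prod :
    refMeasure = (volume : Measure (ℝ × ℝ)).prod (volume.restrict posQuadrant) := by
  conv_rhs => rw [← Measure.restrict_univ (μ := (volume : Measure (ℝ × ℝ)))]
  rw [Measure.prod_restrict, Measure.restrict_univ, refMeasure, ← Measure.volume_eq_prod]

/-- The powers of ρ are redistributed so that the prefactor is exactly the squared normalization of
the theorem and each edge density has a nontrivial pointwise limit. -/
lemma intensity_eq_withDensity (γ₁ γ₂ : ℝ) {f₁ f₂ : ℝ → ℝ} (hf₁ : Measurable f₁)
    (hf₂ : Measurable f₂) (h₁ : ∀ t, 0 < t → 0 ≤ f₁ t) {lam ρ : ℝ} (hlam : 0 ≤ lam) (hρ : 0 < ρ) :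
    intensity lam (scaledLaw (edgeLaw f₁ f₂) ρ) = refMeasure.withDensity fun p =>
      ENNReal.ofReal (lam * ρ ^ (γ₁ + γ₂)) * (ENNReal.ofReal (scaledDensity γ₁ f₁ ρ p.2.1) *
        ENNReal.ofReal (scaledDensity γ₂ f₂ ρ p.2.2)) := by
  rw [intensity, scaledLaw_edgeLaw hf₁ hf₂ h₁ hρ, prod_withDensity_right (by fun_prop),
    ← withDensity_smul _ (by fun_prop), refMeasure_eq_prod]
  congr 1
  ext p
  simp only [Pi.smul_apply, smul_eq_mul, scaledDensity]
  have hp : ρ ^ (γ₁ + γ₂) * ρ ^ (-γ₁) * ρ ^ (-γ₂) = 1 := by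
    rw [← Real.rpow_add hρ, ← Real.rpow_add hρ]
    simp
  have h0 : ∀ γ : ℝ, 0 ≤ ρ ^ γ := fun γ => Real.rpow_nonneg hρ.le γ
  rw [ENNReal.ofReal_mul (h0 _), ENNReal.ofReal_mul (h0 _), ENNReal.ofReal_mul hlam]
  have hp' : ENNReal.ofReal (ρ ^ (γ₁ + γ₂)) * ENNReal.ofReal (ρ ^ (-γ₁)) *
      ENNReal.ofReal (ρ ^ (-γ₂)) = 1 := by
    rw [← ENNReal.ofReal_mul (h0 _), ← ENNReal.ofReal_mul (mul_nonneg (h0 _) (h0 _)), hp,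
      ENNReal.ofReal_one]
  calc _ = ENNReal.ofReal lam * (ENNReal.ofReal (ρ⁻¹ * f₁ (p.2.1 / ρ)) *
        ENNReal.ofReal (ρ⁻¹ * f₂ (p.2.2 / ρ))) * 1 := by rw [mul_one]
    _ = _ := by rw [← hp']; ring

/-- Integration over the centres first, with product weights in the edge lengths. -/
lemma lintegral_refMeasure_mul_le {G : (ℝ × ℝ) × (ℝ × ℝ) → ℝ≥0∞} (hG : Measurable G)
    {a b φ ψ : ℝ → ℝ≥0∞} (ha : Measurable a) (hb : Measurable b) (hφ : Measurable φ)
    (hψ : Measurable ψ) (h : ∀ u ∈ posQuadrant, ∫⁻ x, G (x, u) ≤ a u.1 * b u.2) :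
    ∫⁻ p, G p * (φ p.2.1 * ψ p.2.2) ∂refMeasure
      ≤ (∫⁻ t in Set.Ioi 0, a t * φ t) * ∫⁻ t in Set.Ioi 0, b t * ψ t := by
  rw [refMeasure_eq_prod, lintegral_prod_symm _ (by fun_prop)]
  have h1 : ∀ᵐ u ∂(volume.restrict posQuadrant), ∫⁻ x, G (x, u) * (φ u.1 * ψ u.2)
      ≤ (a u.1 * φ u.1) * (b u.2 * ψ u.2) := by
    filter_upwards [ae_restrict_mem measurableSet_posQuadrant] with u hu
    rw [lintegral_mul_const _ (by fun_prop)]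
    calc _ ≤ (a u.1 * b u.2) * (φ u.1 * ψ u.2) := mul_le_mul_left (h u hu) _
      _ = _ := by ring
  refine (lintegral_mono_ae h1).trans (le_of_eq ?_)
  rw [volume_restrict_posQuadrant, lintegral_prod_mul (f := fun t => a t * φ t)
    (g := fun t => b t * ψ t) (by fun_prop) (by fun_prop)]

/-- The product of the two masses is 1. An infinite factor would make the product ∞ or, by the
convention 0 · ∞ = 0, zero. -/
lemma lintegral_edgeDensity_ne_top {f₁ f₂ : ℝ → ℝ} (hf₁ : Measurable f₁) (hf₂ : Measurable f₂)
    (h₁ : ∀ t, 0 < t → 0 ≤ f₁ t) (hF : IsProbabilityMeasure (edgeLaw f₁ f₂)) :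
    ∫⁻ t in Set.Ioi 0, ENNReal.ofReal (f₁ t) ≠ ∞ ∧ ∫⁻ t in Set.Ioi 0, ENNReal.ofReal (f₂ t) ≠ ∞ := by
  have h := hF.measure_univ
  rw [edgeLaw_eq_prod hf₁ hf₂ h₁, ← Set.univ_prod_univ, Measure.prod_prod,
    withDensity_apply _ MeasurableSet.univ, withDensity_apply _ MeasurableSet.univ,
    Measure.restrict_univ] at h
  constructor <;> intro ht <;> rw [ht] at h
  · rcases eq_or_ne (∫⁻ t in Set.Ioi 0, ENNReal.ofReal (f₂ t)) 0 with h0 | h0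
    · simp [h0] at h
    · simp [ENNReal.top_mul h0] at h
  · rcases eq_or_ne (∫⁻ t in Set.Ioi 0, ENNReal.ofReal (f₁ t)) 0 with h0 | h0
    · simp [h0] at h
    · simp [ENNReal.mul_top h0] at h

/-! ### Tail asymptotics and moment bounds of the edge densities. -/

lemma exists_tail_bound {γ : ℝ} {f : ℝ → ℝ}
    (hf : Asymptotics.IsEquivalent atTop f (fun t => 1 / t ^ (γ + 1))) :
    ∃ T : ℝ, 1 ≤ T ∧ ∀ t, T ≤ t → f t ≤ 2 * (1 / t ^ (γ + 1)) := by
  have h0 : ∀ᶠ t : ℝ in atTop, 1 / t ^ (γ + 1) ≠ 0 := by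
    filter_upwards [eventually_gt_atTop 0] with t ht
    positivity
  have h1 := (Asymptotics.isEquivalent_iff_tendsto_one h0).1 hf
  have h2 := h1.eventually (eventually_lt_nhds (show (1 : ℝ) < 2 by norm_num))
  obtain ⟨T, hT⟩ := eventually_atTop.1 (h2.and (eventually_ge_atTop 1))
  refine ⟨max T 1, le_max_right _ _, fun t ht => ?_⟩
  have h3 := (hT t ((le_max_left _ _).trans ht)).1
  have ht0 : 0 < t := lt_of_lt_of_le zero_lt_one ((le_max_right _ _).trans ht)
  have h4 : 0 < 1 / t ^ (γ + 1) := by positivity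
  rw [Pi.div_apply, div_lt_iff₀ h4] at h3
  exact h3.le

/-- The ratio of f(s) to s^(-γ-1) at s = t/ρ tends to 1, and the normalization cancels every power
of ρ in (t/ρ)^(-γ-1). -/
lemma tendsto_scaledDensity {γ : ℝ} {f : ℝ → ℝ}
    (hf : Asymptotics.IsEquivalent atTop f (fun t => 1 / t ^ (γ + 1))) {t : ℝ} (ht : 0 < t) :
    Tendsto (fun ρ => scaledDensity γ f ρ t) (𝓝[>] 0) (𝓝 (1 / t ^ (γ + 1))) := by
  have h0 : ∀ᶠ t : ℝ in atTop, 1 / t ^ (γ + 1) ≠ 0 := by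
    filter_upwards [eventually_gt_atTop 0] with t ht
    positivity
  have h1 := (Asymptotics.isEquivalent_iff_tendsto_one h0).1 hf
  have h2 : Tendsto (fun ρ : ℝ => t / ρ) (𝓝[>] 0) atTop := by
    simpa [div_eq_mul_inv] using (tendsto_inv_nhdsGT_zero (𝕜 := ℝ)).const_mul_atTop ht
  have h3 := (h1.comp h2).const_mul (1 / t ^ (γ + 1))
  rw [mul_one] at h3
  refine h3.congr' ?_
  filter_upwards [self_mem_nhdsWithin] with ρ hρ
  have hρ : 0 < ρ := hρ
  simp only [Function.comp, Pi.div_apply, scaledDensity]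
  have h4 : ρ ^ γ ≠ 0 := (Real.rpow_pos_of_pos hρ _).ne'
  have h5 : t ^ (γ + 1) ≠ 0 := (Real.rpow_pos_of_pos ht _).ne'
  rw [Real.div_rpow ht.le hρ.le, Real.rpow_add hρ, Real.rpow_one, Real.rpow_neg hρ.le]
  field_simp

/-- Above `ρ T` the scaled density is dominated by its limit. -/
lemma scaledDensity_le {γ T : ℝ} {f : ℝ → ℝ} (hT1 : 1 ≤ T)
    (hT : ∀ t, T ≤ t → f t ≤ 2 * (1 / t ^ (γ + 1))) {ρ t : ℝ} (hρ : 0 < ρ) (ht : ρ * T ≤ t) :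
    scaledDensity γ f ρ t ≤ 2 * (1 / t ^ (γ + 1)) := by
  have ht0 : 0 < t := lt_of_lt_of_le (by positivity) ht
  have h := hT (t / ρ) ((le_div_iff₀ hρ).2 (by linarith))
  unfold scaledDensity
  calc ρ ^ (-γ) * (ρ⁻¹ * f (t / ρ)) ≤ ρ ^ (-γ) * (ρ⁻¹ * (2 * (1 / (t / ρ) ^ (γ + 1)))) := by gcongr
    _ = 2 * (1 / t ^ (γ + 1)) := by
      have h4 : ρ ^ γ ≠ 0 := (Real.rpow_pos_of_pos hρ _).ne'
      have h5 : t ^ (γ + 1) ≠ 0 := (Real.rpow_pos_of_pos ht0 _).ne'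
      rw [Real.div_rpow ht0.le hρ.le, Real.rpow_add hρ, Real.rpow_one, Real.rpow_neg hρ.le]
      field_simp

/-- Near zero the integrand is at most t^(α-γ-1), integrable since α > γ; beyond 1 it is at most
t^(-γ), integrable since γ > 1. -/
lemma lintegral_min_rpow_ne_top {γ α : ℝ} (hγ : 1 < γ) (hα : γ < α) :
    ∫⁻ t in Set.Ioi 0, ENNReal.ofReal (min t (t ^ α)) * ENNReal.ofReal (1 / t ^ (γ + 1)) ≠ ∞ := by
  have h1 : IntegrableOn (fun t : ℝ => t ^ (α - γ - 1)) (Set.Ioo 0 1) :=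
    (intervalIntegral.integrableOn_Ioo_rpow_iff zero_lt_one).2 (by linarith)
  have h2 : IntegrableOn (fun t : ℝ => t ^ (-γ)) (Set.Ioi 1) :=
    integrableOn_Ioi_rpow_of_lt (by linarith) zero_lt_one
  have hU : Set.Ioi (0 : ℝ) ⊆ Set.Ioo 0 1 ∪ Set.Ici 1 := fun t ht => by
    rcases lt_or_ge t 1 with h | h
    · exact Or.inl ⟨ht, h⟩
    · exact Or.inr h
  refine ((lintegral_mono_set hU).trans (lintegral_union_le _ _ _)).trans_lt
    (ENNReal.add_lt_top.2 ⟨?_, ?_⟩) |>.ne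
  · refine lt_of_le_of_lt (setLIntegral_mono' measurableSet_Ioo fun t ht => ?_) h1.lintegral_lt_top
    rw [← ENNReal.ofReal_mul (le_min ht.1.le (Real.rpow_nonneg ht.1.le _))]
    refine ENNReal.ofReal_le_ofReal ?_
    have ht0 := ht.1
    calc min t (t ^ α) * (1 / t ^ (γ + 1)) ≤ t ^ α * (1 / t ^ (γ + 1)) := by
          gcongr; exact min_le_right _ _
      _ = t ^ (α - γ - 1) := by
          rw [mul_one_div, ← Real.rpow_sub ht0]; congr 1; ring
  · rw [setLIntegral_congr Ioi_ae_eq_Ici.symm]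
    refine lt_of_le_of_lt (setLIntegral_mono' measurableSet_Ioi fun t ht => ?_) h2.lintegral_lt_top
    have ht0 : 0 < t := lt_trans zero_lt_one ht
    rw [← ENNReal.ofReal_mul (le_min ht0.le (Real.rpow_nonneg ht0.le _))]
    refine ENNReal.ofReal_le_ofReal ?_
    calc min t (t ^ α) * (1 / t ^ (γ + 1)) ≤ t * (1 / t ^ (γ + 1)) := by
          gcongr; exact min_le_left _ _
      _ = t ^ (-γ) := by
          rw [mul_one_div, Real.rpow_add ht0, Real.rpow_one, Real.rpow_neg ht0.le]
          field_simp

/-- The contribution of the edge lengths below `ρ T`. -/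
lemma lintegral_small_edges_le {γ α T : ℝ} (hα : 0 ≤ α) (hT : 0 ≤ T) {f : ℝ → ℝ}
    (hf : Measurable f) {ρ : ℝ} (hρ : 0 < ρ) :
    ∫⁻ t in Set.Ioi 0, ENNReal.ofReal (min t (t ^ α)) *
      (Set.Iio (ρ * T)).indicator (fun t => ENNReal.ofReal (scaledDensity γ f ρ t)) t
      ≤ ENNReal.ofReal (T ^ α * ρ ^ (α - γ)) * ∫⁻ t in Set.Ioi 0, ENNReal.ofReal (f t) := by
  -- Below ρT the weight is at most (ρT)^α, while the normalized density has total mass ρ^(-γ) ∫f;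
  -- this yields T^α ρ^(α-γ).
  have h : ∀ t ∈ Set.Ioi (0 : ℝ), ENNReal.ofReal (min t (t ^ α)) *
      (Set.Iio (ρ * T)).indicator (fun t => ENNReal.ofReal (scaledDensity γ f ρ t)) t
      ≤ ENNReal.ofReal ((ρ * T) ^ α) * ENNReal.ofReal (scaledDensity γ f ρ t) := by
    intro t ht
    by_cases hlt : t < ρ * T
    · rw [Set.indicator_of_mem (Set.mem_Iio.2 hlt)]
      gcongr
      exact (min_le_right _ _).trans (Real.rpow_le_rpow (le_of_lt ht) hlt.le hα)
    · rw [Set.indicator_of_notMem (by simpa using hlt), mul_zero]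
      exact zero_le
  refine (setLIntegral_mono' measurableSet_Ioi h).trans (le_of_eq ?_)
  rw [lintegral_const_mul _ (measurable_scaledDensity hf ρ).ennreal_ofReal,
    lintegral_scaledDensity γ hf hρ, ← mul_assoc, ← ENNReal.ofReal_mul (by positivity)]
  congr 2
  rw [Real.mul_rpow hρ.le hT, sub_eq_add_neg, Real.rpow_add hρ]
  ring

/-- Cut at ρT: below, the small-edge bound; above, the tail bound. In the applications 1 < γ < α and
f is integrable, so the right side stays bounded as ρ → 0. -/
lemma lintegral_min_scaledDensity_le {γ α T : ℝ} (hα : 0 ≤ α) (hT1 : 1 ≤ T) {f : ℝ → ℝ}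
    (hf : Measurable f) (hT : ∀ t, T ≤ t → f t ≤ 2 * (1 / t ^ (γ + 1))) {ρ : ℝ} (hρ : 0 < ρ) :
    ∫⁻ t in Set.Ioi 0, ENNReal.ofReal (min t (t ^ α)) * ENNReal.ofReal (scaledDensity γ f ρ t)
      ≤ ENNReal.ofReal (T ^ α * ρ ^ (α - γ)) * (∫⁻ t in Set.Ioi 0, ENNReal.ofReal (f t)) +
        2 * ∫⁻ t in Set.Ioi 0, ENNReal.ofReal (min t (t ^ α)) *
          ENNReal.ofReal (1 / t ^ (γ + 1)) := by
  refine le_trans ?_ (add_le_add_left (lintegral_small_edges_le (γ := γ) hα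
    (zero_le_one.trans hT1) hf hρ) _)
  rw [← lintegral_const_mul _ (by fun_prop), ← lintegral_add_right _ (by fun_prop)]
  refine setLIntegral_mono' measurableSet_Ioi fun t ht => ?_
  by_cases hlt : t < ρ * T
  · rw [Set.indicator_of_mem (Set.mem_Iio.2 hlt)]
    exact le_self_add
  · refine le_trans ?_ le_add_self
    have := scaledDensity_le hT1 hT hρ (not_lt.1 hlt)
    calc ENNReal.ofReal (min t (t ^ α)) * ENNReal.ofReal (scaledDensity γ f ρ t)
        ≤ ENNReal.ofReal (min t (t ^ α)) * ENNReal.ofReal (2 * (1 / t ^ (γ + 1))) := by gcongr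
      _ = _ := by
        rw [ENNReal.ofReal_mul zero_le_two, ENNReal.ofReal_ofNat]; ring

lemma lintegral_mul_edgeDensity_ne_top {γ : ℝ} (hγ : 1 < γ) {f : ℝ → ℝ} (hf : Measurable f)
    (hfa : Asymptotics.IsEquivalent atTop f (fun t => 1 / t ^ (γ + 1)))
    (hfi : ∫⁻ t in Set.Ioi 0, ENNReal.ofReal (f t) ≠ ∞) :
    ∫⁻ t in Set.Ioi 0, ENNReal.ofReal t * ENNReal.ofReal (f t) ≠ ∞ := by
  obtain ⟨T, hT1, hT⟩ := exists_tail_bound hfa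
  -- With α = γ + 1 the weight equals t on [1, ∞), so 2K bounds the tail of the first moment.
  set K := ∫⁻ t in Set.Ioi 0, ENNReal.ofReal (min t (t ^ (γ + 1))) *
    ENNReal.ofReal (1 / t ^ (γ + 1)) with hK
  have hKfin : K ≠ ∞ := lintegral_min_rpow_ne_top hγ (by linarith)
  have h : ∫⁻ t in Set.Ioi 0, ENNReal.ofReal t * ENNReal.ofReal (f t)
      ≤ ENNReal.ofReal T * (∫⁻ t in Set.Ioi 0, ENNReal.ofReal (f t)) + 2 * K := by
    rw [hK, ← lintegral_const_mul _ (by fun_prop), ← lintegral_const_mul _ (by fun_prop),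
      ← lintegral_add_right _ (by fun_prop)]
    refine setLIntegral_mono' measurableSet_Ioi fun t ht => ?_
    rcases le_total t T with hlt | hlt
    · refine le_trans ?_ le_self_add
      gcongr
    · refine le_trans ?_ le_add_self
      have h1 : (1 : ℝ) ≤ t := hT1.trans hlt
      have h2 : t ≤ t ^ (γ + 1) := Real.self_le_rpow_of_one_le h1 (by linarith)
      rw [min_eq_left h2]
      calc ENNReal.ofReal t * ENNReal.ofReal (f t)
          ≤ ENNReal.ofReal t * ENNReal.ofReal (2 * (1 / t ^ (γ + 1))) := by
            gcongr; exact hT t hlt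
        _ = _ := by rw [ENNReal.ofReal_mul zero_le_two, ENNReal.ofReal_ofNat]; ring
  refine (h.trans_lt ?_).ne
  exact ENNReal.add_lt_top.2 ⟨ENNReal.mul_lt_top ENNReal.ofReal_lt_top hfi.lt_top,
    ENNReal.mul_lt_top (by simp) hKfin.lt_top⟩

end RandomBoxes

namespace RandomBoxes

/-! ### Masses of boxes -/

lemma measurableSet_box (x u : ℝ × ℝ) : MeasurableSet (box x u) :=
  measurableSet_Icc.prod measurableSet_Icc

lemma measurableSet_mem_box :
    MeasurableSet {q : ((ℝ × ℝ) × (ℝ × ℝ)) × (ℝ × ℝ) | q.2 ∈ box q.1.1 q.1.2} := by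
  have hle : ∀ f g : ((ℝ × ℝ) × (ℝ × ℝ)) × (ℝ × ℝ) → ℝ, Measurable f → Measurable g →
      MeasurableSet {q | f q ≤ g q} := fun f g hf hg => measurableSet_le hf hg
  exact ((hle (fun q => q.1.1.1 - q.1.2.1 / 2) (fun q => q.2.1) (by fun_prop) (by fun_prop)).inter
    (hle (fun q => q.2.1) (fun q => q.1.1.1 + q.1.2.1 / 2) (by fun_prop) (by fun_prop))).inter
    ((hle (fun q => q.1.1.2 - q.1.2.2 / 2) (fun q => q.2.2) (by fun_prop) (by fun_prop)).inter
    (hle (fun q => q.2.2) (fun q => q.1.1.2 + q.1.2.2 / 2) (by fun_prop) (by fun_prop)))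

lemma measurable_measure_box (ν : Measure (ℝ × ℝ)) [SFinite ν] :
    Measurable fun p : (ℝ × ℝ) × (ℝ × ℝ) => ν (box p.1 p.2) :=
  measurable_measure_prodMk_left measurableSet_mem_box

lemma signedMeasure_box (μ : SignedMeasure (ℝ × ℝ)) (x u : ℝ × ℝ) :
    μ (box x u) = (μ.toJordanDecomposition.posPart (box x u)).toReal -
      (μ.toJordanDecomposition.negPart (box x u)).toReal :=
  μ.apply_eq_posPart_real_sub_negPart_real (measurableSet_box x u)

lemma measurable_signedMeasure_box (μ : SignedMeasure (ℝ × ℝ)) :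
    Measurable fun p : (ℝ × ℝ) × (ℝ × ℝ) => μ (box p.1 p.2) := by
  simp_rw [signedMeasure_box]
  exact (measurable_measure_box _).ennreal_toReal.sub (measurable_measure_box _).ennreal_toReal

lemma mem_box_comm (x y u : ℝ × ℝ) : y ∈ box x u ↔ x ∈ box y u := by
  simp only [box, Set.mem_prod, Set.mem_Icc]
  constructor <;> rintro ⟨⟨h1, h2⟩, h3, h4⟩ <;> refine ⟨⟨?_, ?_⟩, ?_, ?_⟩ <;> linarith

lemma volume_box (x u : ℝ × ℝ) :
    volume (box x u) = ENNReal.ofReal u.1 * ENNReal.ofReal u.2 := by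
  rw [box, Measure.volume_eq_prod, Measure.prod_prod, Real.volume_Icc, Real.volume_Icc]
  congr 2 <;> ring

/-- Fubini on the incidence relation y ∈ B(x,u), which is symmetric in x and y: integrating over x
first gives the area of a box for every y. -/
lemma lintegral_measure_box (ν : Measure (ℝ × ℝ)) [SFinite ν] (u : ℝ × ℝ) :
    ∫⁻ x, ν (box x u) = ν Set.univ * (ENNReal.ofReal u.1 * ENNReal.ofReal u.2) := by
  have hS : MeasurableSet {q : (ℝ × ℝ) × (ℝ × ℝ) | q.2 ∈ box q.1 u} :=
    measurableSet_mem_box.preimage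
      (f := fun q : (ℝ × ℝ) × (ℝ × ℝ) => ((q.1, u), q.2)) (by fun_prop)
  have h1 := Measure.prod_apply (μ := (volume : Measure (ℝ × ℝ))) (ν := ν) hS
  have h2 := Measure.prod_apply_symm (μ := (volume : Measure (ℝ × ℝ))) (ν := ν) hS
  have h3 : ∀ y, (fun x : ℝ × ℝ => (x, y)) ⁻¹' {q | q.2 ∈ box q.1 u} = box y u := fun y => by
    ext x
    exact mem_box_comm x y u
  have h4 : ∀ x, Prod.mk x ⁻¹' {q : (ℝ × ℝ) × (ℝ × ℝ) | q.2 ∈ box q.1 u} = box x u := fun x => rfl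
  simp_rw [h3, volume_box, lintegral_const] at h2
  simp_rw [h4] at h1
  rw [← h1, h2, mul_comm]

lemma enorm_signedMeasure_box_le (μ : SignedMeasure (ℝ × ℝ)) (x u : ℝ × ℝ) :
    ‖μ (box x u)‖ₑ ≤ μ.totalVariation (box x u) := by
  rw [signedMeasure_box, SignedMeasure.totalVariation, Measure.add_apply]
  refine (enorm_sub_le (E := ℝ)).trans ?_
  rw [Real.enorm_of_nonneg ENNReal.toReal_nonneg, Real.enorm_of_nonneg ENNReal.toReal_nonneg,
    ENNReal.ofReal_toReal (measure_ne_top _ _), ENNReal.ofReal_toReal (measure_ne_top _ _)]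

lemma isProbabilityMeasure_scaledLaw {F : Measure (ℝ × ℝ)} (hF : IsProbabilityMeasure F) (ρ : ℝ) :
    IsProbabilityMeasure (scaledLaw F ρ) :=
  Measure.isProbabilityMeasure_map (by fun_prop)

lemma sigmaFinite_intensity {F : Measure (ℝ × ℝ)} [SigmaFinite F] (lam : ℝ) :
    SigmaFinite (intensity lam F) := by
  change SigmaFinite (lam.toNNReal • (volume : Measure (ℝ × ℝ)).prod F)
  infer_instance

lemma lintegral_intensity {F : Measure (ℝ × ℝ)} [SigmaFinite F] (lam : ℝ)
    {h : (ℝ × ℝ) × (ℝ × ℝ) → ℝ≥0∞} (hh : Measurable h) :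
    ∫⁻ p, h p ∂(intensity lam F) = ENNReal.ofReal lam * ∫⁻ u, (∫⁻ x, h (x, u)) ∂F := by
  rw [intensity, lintegral_smul_measure, lintegral_prod_symm _ hh.aemeasurable, smul_eq_mul]

/-- The masses of the boxes are integrable with respect to the intensity measure. -/
lemma integrable_box_intensity {γ₁ γ₂ : ℝ} (hγ₁ : 1 < γ₁) (hγ₂ : 1 < γ₂) {f₁ f₂ : ℝ → ℝ}
    (hf₁m : Measurable f₁) (hf₂m : Measurable f₂) (hf₁0 : ∀ t, 0 < t → 0 ≤ f₁ t)
    (hf₁ : Asymptotics.IsEquivalent atTop f₁ (fun t => 1 / t ^ (γ₁ + 1)))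
    (hf₂ : Asymptotics.IsEquivalent atTop f₂ (fun t => 1 / t ^ (γ₂ + 1)))
    (hF : IsProbabilityMeasure (edgeLaw f₁ f₂)) (lam : ℝ) {ρ : ℝ} (hρ : 0 < ρ)
    (μ : SignedMeasure (ℝ × ℝ)) :
    Integrable (fun p : (ℝ × ℝ) × (ℝ × ℝ) => μ (box p.1 p.2))
      (intensity lam (scaledLaw (edgeLaw f₁ f₂) ρ)) := by
  have := isProbabilityMeasure_scaledLaw hF ρ
  refine ⟨(measurable_signedMeasure_box μ).aestronglyMeasurable, ?_⟩
  have hfin : ∀ {γ : ℝ} {f : ℝ → ℝ}, 1 < γ → Measurable f →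
      Asymptotics.IsEquivalent atTop f (fun t => 1 / t ^ (γ + 1)) →
      ∫⁻ t in Set.Ioi 0, ENNReal.ofReal (f t) ≠ ∞ →
      ∫⁻ t, ENNReal.ofReal (ρ * t)
        ∂((volume.restrict (Set.Ioi 0)).withDensity fun t => ENNReal.ofReal (f t)) < ∞ := by
    intro γ f hγ hfm hf hfi
    rw [lintegral_withDensity_eq_lintegral_mul _ hfm.ennreal_ofReal (by fun_prop)]
    simp only [Pi.mul_apply, ENNReal.ofReal_mul hρ.le]
    have h1 : ∀ t : ℝ, ENNReal.ofReal (f t) * (ENNReal.ofReal ρ * ENNReal.ofReal t)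
        = ENNReal.ofReal ρ * (ENNReal.ofReal t * ENNReal.ofReal (f t)) := fun t => by ring
    simp_rw [h1]
    rw [lintegral_const_mul _ (by fun_prop)]
    exact ENNReal.mul_lt_top ENNReal.ofReal_lt_top
      (lintegral_mul_edgeDensity_ne_top hγ hfm hf hfi).lt_top
  have hedge := lintegral_edgeDensity_ne_top hf₁m hf₂m hf₁0 hF
  have hm := (measurable_signedMeasure_box μ).enorm
  rw [HasFiniteIntegral, lintegral_intensity _ hm]
  refine ENNReal.mul_lt_top ENNReal.ofReal_lt_top ?_
  -- Integrated over the centres, |μ(B(x,u))| costs at most the total variation times u₁u₂. Only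
  -- first moments of the edge lengths are needed, and γᵢ > 1 makes them finite.
  have h2 : ∀ u : ℝ × ℝ, ∫⁻ x, ‖μ (box x u)‖ₑ
      ≤ μ.totalVariation Set.univ * (ENNReal.ofReal u.1 * ENNReal.ofReal u.2) := fun u =>
    (lintegral_mono fun x => enorm_signedMeasure_box_le μ x u).trans_eq
      (lintegral_measure_box μ.totalVariation u)
  refine (lintegral_mono h2).trans_lt ?_
  rw [lintegral_const_mul _ (by fun_prop)]
  refine ENNReal.mul_lt_top (measure_lt_top _ _) ?_
  rw [scaledLaw, lintegral_map (by fun_prop) (by fun_prop), edgeLaw_eq_prod hf₁m hf₂m hf₁0]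
  simp only [Prod.smul_fst, Prod.smul_snd, smul_eq_mul]
  rw [lintegral_prod_mul (f := fun t => ENNReal.ofReal (ρ * t))
    (g := fun t => ENNReal.ofReal (ρ * t)) (by fun_prop) (by fun_prop)]
  exact ENNReal.mul_lt_top (hfin hγ₁ hf₁m hf₁ hedge.1) (hfin hγ₂ hf₂m hf₂ hedge.2)

/-! ### Square integrability of admissible measures -/

/-- Admissibility reduces integrals over boxes to products of one-dimensional integrals. The weights
are left free because the lemma is applied to limiting power densities, scaled densities and
truncated scaled densities. -/
lemma exists_lintegral_sq_box_le {γ₁ γ₂ : ℝ} {μ : SignedMeasure (ℝ × ℝ)}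
    (hμ : μ ∈ admissible γ₁ γ₂) :
    ∃ (C : ℝ≥0∞) (α₁ α₂ : ℝ), C ≠ ∞ ∧ γ₁ < α₁ ∧ γ₂ < α₂ ∧
      ∀ φ ψ : ℝ → ℝ≥0∞, Measurable φ → Measurable ψ →
        ∫⁻ p, ENNReal.ofReal (μ (box p.1 p.2) ^ 2) * (φ p.2.1 * ψ p.2.2) ∂refMeasure
          ≤ C * ((∫⁻ t in Set.Ioi 0, ENNReal.ofReal (min t (t ^ α₁)) * φ t) *
            ∫⁻ t in Set.Ioi 0, ENNReal.ofReal (min t (t ^ α₂)) * ψ t) := by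
  obtain ⟨C, α₁, α₂, hC, h1, -, h2, -, h⟩ := hμ
  refine ⟨ENNReal.ofReal C, α₁, α₂, ENNReal.ofReal_ne_top, h1, h2, fun φ ψ hφ hψ => ?_⟩
  have hm := ((measurable_signedMeasure_box μ).pow_const 2).ennreal_ofReal
  refine (lintegral_refMeasure_mul_le hm
    (a := fun t => ENNReal.ofReal C * ENNReal.ofReal (min t (t ^ α₁)))
    (b := fun t => ENNReal.ofReal (min t (t ^ α₂))) (by fun_prop) (by fun_prop) hφ hψ
    fun u hu => (h u hu).trans_eq ?_).trans_eq ?_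
  · have h3 : 0 ≤ min u.1 (u.1 ^ α₁) :=
      le_min (le_of_lt hu.1) (Real.rpow_nonneg (le_of_lt hu.1) _)
    rw [ENNReal.ofReal_mul (mul_nonneg hC.le h3), ENNReal.ofReal_mul hC.le]
  · simp_rw [mul_assoc (ENNReal.ofReal C)]
    rw [lintegral_const_mul _ (by fun_prop), mul_assoc]

lemma ae_refMeasure : ∀ᵐ p ∂refMeasure, 0 < p.2.1 ∧ 0 < p.2.2 := by
  filter_upwards [ae_restrict_mem (MeasurableSet.univ.prod measurableSet_posQuadrant)] with p hp
  exact hp.2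

lemma measurable_covIntegrand (γ₁ γ₂ : ℝ) (μ ν : SignedMeasure (ℝ × ℝ)) :
    Measurable (covIntegrand γ₁ γ₂ μ ν) := by
  have h1 := measurable_signedMeasure_box μ
  have h2 := measurable_signedMeasure_box ν
  exact ((h1.mul h2).mul (by fun_prop)).mul (by fun_prop)

lemma integrable_covIntegrand_self {γ₁ γ₂ : ℝ} (hγ₁ : 1 < γ₁) (hγ₂ : 1 < γ₂)
    {μ : SignedMeasure (ℝ × ℝ)} (hμ : μ ∈ admissible γ₁ γ₂) :
    Integrable (covIntegrand γ₁ γ₂ μ μ) refMeasure := by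
  obtain ⟨C, α₁, α₂, hC, h1, h2, h⟩ := exists_lintegral_sq_box_le hμ
  refine ⟨(measurable_covIntegrand _ _ _ _).aestronglyMeasurable, ?_⟩
  have h3 := h (fun t => ENNReal.ofReal (1 / t ^ (γ₁ + 1)))
    (fun t => ENNReal.ofReal (1 / t ^ (γ₂ + 1))) (by fun_prop) (by fun_prop)
  refine lt_of_le_of_lt (lintegral_mono_ae ?_) (h3.trans_lt (ENNReal.mul_lt_top hC.lt_top
    (ENNReal.mul_lt_top (lintegral_min_rpow_ne_top hγ₁ h1).lt_top
      (lintegral_min_rpow_ne_top hγ₂ h2).lt_top)))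
  filter_upwards [ae_refMeasure] with p hp
  have hp1 := hp.1
  have hp2 := hp.2
  rw [← ENNReal.ofReal_mul (by positivity), ← ENNReal.ofReal_mul (by positivity),
    Real.enorm_eq_ofReal_abs, covIntegrand, ← sq, abs_of_nonneg (by positivity), mul_assoc]

/-- The pointwise inequality |ab| ≤ a² + b² reduces the claim to the diagonal case. -/
lemma integrable_covIntegrand {γ₁ γ₂ : ℝ} (hγ₁ : 1 < γ₁) (hγ₂ : 1 < γ₂)
    {μ ν : SignedMeasure (ℝ × ℝ)} (hμ : μ ∈ admissible γ₁ γ₂) (hν : ν ∈ admissible γ₁ γ₂) :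
    Integrable (covIntegrand γ₁ γ₂ μ ν) refMeasure := by
  refine ((integrable_covIntegrand_self hγ₁ hγ₂ hμ).add
    (integrable_covIntegrand_self hγ₁ hγ₂ hν)).mono
    (measurable_covIntegrand _ _ _ _).aestronglyMeasurable ?_
  filter_upwards [ae_refMeasure] with p hp
  have hp1 := hp.1
  have hp2 := hp.2
  simp only [Pi.add_apply, covIntegrand, Real.norm_eq_abs, ← add_mul]
  rw [abs_mul, abs_mul, abs_mul _ (1 / p.2.2 ^ (γ₂ + 1)), abs_mul _ (1 / p.2.1 ^ (γ₁ + 1))]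
  gcongr ?_ * _ * _
  rw [abs_mul]
  refine le_trans ?_ (le_abs_self _)
  nlinarith [sq_nonneg (|μ (box p.1 p.2)| - |ν (box p.1 p.2)|), sq_abs (μ (box p.1 p.2)),
    sq_abs (ν (box p.1 p.2)), sq_nonneg (μ (box p.1 p.2)), sq_nonneg (ν (box p.1 p.2))]

/-! ### The normalized exponent -/

/-- The second order remainder of the exponential, normalized at level `σ`. -/
noncomputable def expRemainder (σ y : ℝ) : ℂ :=
  (σ : ℂ) * (Complex.exp ((y / √σ : ℝ) * Complex.I) - 1 - ((y / √σ : ℝ) : ℂ) * Complex.I)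

lemma measurable_expRemainder (σ : ℝ) : Measurable (expRemainder σ) := by
  unfold expRemainder
  fun_prop

/-- For |x| ≤ 1 this is the second-order power series bound; for |x| ≥ 1 the triangle inequality
gives 2|x| ≤ 2x². -/
lemma norm_cexp_sub_one_sub_le (x : ℝ) :
    ‖Complex.exp (x * Complex.I) - 1 - x * Complex.I‖ ≤ 2 * x ^ 2 := by
  have hx : ‖(x : ℂ) * Complex.I‖ = |x| := by simp
  rcases le_total |x| 1 with h | h
  · have := Complex.norm_exp_sub_one_sub_id_le (x := x * Complex.I) (by rw [hx]; exact h)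
    rw [hx, sq_abs] at this
    nlinarith [sq_nonneg x]
  · have h1 : ‖Complex.exp (x * Complex.I) - 1‖ ≤ |x| := by
      simpa using norm_cexp_mul_I_sub_le x 0
    have h2 := norm_sub_le (Complex.exp (x * Complex.I) - 1) (x * Complex.I)
    rw [hx] at h2
    nlinarith [sq_abs x]

/-- The bound does not depend on σ, which makes it usable for domination. -/
lemma norm_expRemainder_le {σ : ℝ} (hσ : 0 < σ) (y : ℝ) : ‖expRemainder σ y‖ ≤ 2 * y ^ 2 := by
  have h := norm_cexp_sub_one_sub_le (y / √σ)
  rw [div_pow, Real.sq_sqrt hσ.le] at h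
  rw [expRemainder, norm_mul, Complex.norm_real, Real.norm_of_nonneg hσ.le]
  calc _ ≤ σ * (2 * (y ^ 2 / σ)) := by gcongr
    _ = 2 * y ^ 2 := by field_simp

/-- Taylor expansion to third order: the error is at most σ(|y|/√σ)³ = |y|³/√σ. -/
lemma tendsto_expRemainder (y : ℝ) :
    Tendsto (fun σ => expRemainder σ y) atTop (𝓝 (-(1 / 2) * (y : ℂ) ^ 2)) := by
  rw [tendsto_iff_norm_sub_tendsto_zero]
  have hlim : Tendsto (fun σ : ℝ => |y| ^ 3 / √σ) atTop (𝓝 0) :=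
    (tendsto_const_nhds.div_atTop Real.tendsto_sqrt_atTop)
  refine squeeze_zero' (Eventually.of_forall fun _ => norm_nonneg _) ?_ hlim
  filter_upwards [eventually_gt_atTop 0, eventually_ge_atTop (y ^ 2)] with σ hσ hy
  have hs : 0 < √σ := Real.sqrt_pos.2 hσ
  have hss : √σ * √σ = σ := Real.mul_self_sqrt hσ.le
  have hz : ‖((y / √σ : ℝ) : ℂ) * Complex.I‖ = |y| / √σ := by
    rw [norm_mul, Complex.norm_I, mul_one, Complex.norm_real, Real.norm_eq_abs, abs_div,
      abs_of_pos hs]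
  have hle : |y| / √σ ≤ 1 := by
    rw [div_le_one hs]
    exact Real.abs_le_sqrt hy
  have h := Complex.exp_bound (x := ((y / √σ : ℝ) : ℂ) * Complex.I) (by rw [hz]; exact hle)
    (n := 3) (by norm_num)
  rw [hz] at h
  have hid : expRemainder σ y - -(1 / 2) * (y : ℂ) ^ 2
      = (σ : ℂ) * (Complex.exp (((y / √σ : ℝ) : ℂ) * Complex.I) -
        ∑ m ∈ Finset.range 3, (((y / √σ : ℝ) : ℂ) * Complex.I) ^ m / (m.factorial : ℂ)) := by
    have hsq : (σ : ℂ) * ((y / √σ : ℝ) : ℂ) ^ 2 = (y : ℂ) ^ 2 := by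
      rw [← Complex.ofReal_pow, ← Complex.ofReal_mul, ← Complex.ofReal_pow, div_pow,
        Real.sq_sqrt hσ.le, mul_div_cancel₀ _ hσ.ne']
    simp only [expRemainder, Finset.sum_range_succ, Finset.sum_range_zero, Nat.factorial, mul_pow,
      Complex.I_sq]
    rw [← hsq]
    push_cast
    ring
  rw [hid, norm_mul, Complex.norm_real, Real.norm_of_nonneg hσ.le]
  -- The constant 4/(3! · 3) of the Taylor estimate is rounded up to 1.
  have hc : ((Nat.succ 3 : ℕ) : ℝ) * (((Nat.factorial 3 : ℕ) : ℝ) * ((3 : ℕ) : ℝ))⁻¹ ≤ 1 := by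
    norm_num [Nat.factorial]
  calc _ ≤ σ * ((|y| / √σ) ^ 3 * 1) := by
        gcongr
        refine h.trans ?_
        gcongr
    _ = |y| ^ 3 / √σ := by
        rw [mul_one, div_pow, pow_succ (√σ) 2, Real.sq_sqrt hσ.le]
        field_simp

end RandomBoxes

namespace RandomBoxes

/-! ### Convergence of the exponent -/

/-- Pairs whose two edge lengths are at least `r`. -/
def largeEdges (r : ℝ) : Set ((ℝ × ℝ) × (ℝ × ℝ)) := {p | r ≤ p.2.1 ∧ r ≤ p.2.2}

lemma measurableSet_largeEdges (r : ℝ) : MeasurableSet (largeEdges r) :=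
  (measurableSet_le (f := fun _ => r) (g := fun p : (ℝ × ℝ) × (ℝ × ℝ) => p.2.1)
    measurable_const (by fun_prop)).inter
    (measurableSet_le (f := fun _ => r) (g := fun p : (ℝ × ℝ) × (ℝ × ℝ) => p.2.2)
      measurable_const (by fun_prop))

/-- The exponent of the characteristic function, written as an integral against Lebesgue
measure. -/
lemma integral_intensity_eq {γ₁ γ₂ : ℝ} {f₁ f₂ : ℝ → ℝ} (hf₁m : Measurable f₁)
    (hf₂m : Measurable f₂) (hf₁0 : ∀ t, 0 < t → 0 ≤ f₁ t) (hf₂0 : ∀ t, 0 < t → 0 ≤ f₂ t)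
    {lam ρ : ℝ} (hlam : 0 < lam) (hρ : 0 < ρ) (μ : SignedMeasure (ℝ × ℝ)) :
    ∫ p, (Complex.exp ((μ (box p.1 p.2) / √(lam * ρ ^ (γ₁ + γ₂)) : ℝ) * Complex.I) - 1 -
        ((μ (box p.1 p.2) / √(lam * ρ ^ (γ₁ + γ₂)) : ℝ) : ℂ) * Complex.I)
        ∂(intensity lam (scaledLaw (edgeLaw f₁ f₂) ρ))
      = ∫ p, (scaledDensity γ₁ f₁ ρ p.2.1 * scaledDensity γ₂ f₂ ρ p.2.2) •
          expRemainder (lam * ρ ^ (γ₁ + γ₂)) (μ (box p.1 p.2)) ∂refMeasure := by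
  have hs₁ := measurable_scaledDensity (γ := γ₁) hf₁m ρ
  have hs₂ := measurable_scaledDensity (γ := γ₂) hf₂m ρ
  rw [intensity_eq_withDensity γ₁ γ₂ hf₁m hf₂m hf₁0 hlam.le hρ,
    integral_withDensity_eq_integral_toReal_smul (by fun_prop)
      (Eventually.of_forall fun p => ENNReal.mul_lt_top ENNReal.ofReal_lt_top
        (ENNReal.mul_lt_top ENNReal.ofReal_lt_top ENNReal.ofReal_lt_top))]
  refine integral_congr_ae ?_
  filter_upwards [ae_refMeasure] with p hp
  have h1 := scaledDensity_nonneg (γ := γ₁) hf₁0 hρ hp.1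
  have h2 := scaledDensity_nonneg (γ := γ₂) hf₂0 hρ hp.2
  have h3 : 0 ≤ lam * ρ ^ (γ₁ + γ₂) := by positivity
  rw [ENNReal.toReal_mul, ENNReal.toReal_mul, ENNReal.toReal_ofReal h1, ENNReal.toReal_ofReal h2,
    ENNReal.toReal_ofReal h3, expRemainder, Complex.real_smul, Complex.real_smul]
  push_cast
  ring

section Limit

variable {γ₁ γ₂ : ℝ} {f₁ f₂ : ℝ → ℝ} {μ : SignedMeasure (ℝ × ℝ)} {ι : Type*} {l : Filter ι}
  {r σ : ι → ℝ}

lemma measurable_smul_expRemainder (hf₁m : Measurable f₁) (hf₂m : Measurable f₂) (ρ s : ℝ) :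
    Measurable fun p : (ℝ × ℝ) × (ℝ × ℝ) =>
      (scaledDensity γ₁ f₁ ρ p.2.1 * scaledDensity γ₂ f₂ ρ p.2.2) •
        expRemainder s (μ (box p.1 p.2)) := by
  have hs₁ := measurable_scaledDensity (γ := γ₁) hf₁m ρ
  have hs₂ := measurable_scaledDensity (γ := γ₂) hf₂m ρ
  have h := (measurable_expRemainder s).comp (measurable_signedMeasure_box μ)
  have h' : Measurable fun p : (ℝ × ℝ) × (ℝ × ℝ) =>
      scaledDensity γ₁ f₁ ρ p.2.1 * scaledDensity γ₂ f₂ ρ p.2.2 := by fun_prop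
  exact h'.smul h

lemma enorm_smul_expRemainder_le (hf₁0 : ∀ t, 0 < t → 0 ≤ f₁ t) (hf₂0 : ∀ t, 0 < t → 0 ≤ f₂ t)
    {ρ s : ℝ} (hρ : 0 < ρ) (hs : 0 < s) {p : (ℝ × ℝ) × (ℝ × ℝ)} (hp : 0 < p.2.1 ∧ 0 < p.2.2) :
    ‖(scaledDensity γ₁ f₁ ρ p.2.1 * scaledDensity γ₂ f₂ ρ p.2.2) •
        expRemainder s (μ (box p.1 p.2))‖ₑ
      ≤ 2 * (ENNReal.ofReal (μ (box p.1 p.2) ^ 2) *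
        (ENNReal.ofReal (scaledDensity γ₁ f₁ ρ p.2.1) *
          ENNReal.ofReal (scaledDensity γ₂ f₂ ρ p.2.2))) := by
  have h1 := scaledDensity_nonneg (γ := γ₁) hf₁0 hρ hp.1
  have h2 := scaledDensity_nonneg (γ := γ₂) hf₂0 hρ hp.2
  rw [← ofReal_norm, ← ENNReal.ofReal_mul h1, ← ENNReal.ofReal_mul (sq_nonneg _),
    ← ENNReal.ofReal_ofNat, ← ENNReal.ofReal_mul zero_le_two, norm_smul,
    Real.norm_of_nonneg (mul_nonneg h1 h2)]
  refine ENNReal.ofReal_le_ofReal ?_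
  calc _ ≤ (scaledDensity γ₁ f₁ ρ p.2.1 * scaledDensity γ₂ f₂ ρ p.2.2) *
        (2 * μ (box p.1 p.2) ^ 2) := by
        gcongr
        exact norm_expRemainder_le hs _
    _ = _ := by ring

/-- Integrability of the exponent against Lebesgue measure. -/
lemma integrable_smul_expRemainder (hγ₁ : 1 < γ₁) (hγ₂ : 1 < γ₂) (hf₁m : Measurable f₁)
    (hf₂m : Measurable f₂) (hf₁0 : ∀ t, 0 < t → 0 ≤ f₁ t) (hf₂0 : ∀ t, 0 < t → 0 ≤ f₂ t)
    (hf₁ : Asymptotics.IsEquivalent atTop f₁ (fun t => 1 / t ^ (γ₁ + 1)))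
    (hf₂ : Asymptotics.IsEquivalent atTop f₂ (fun t => 1 / t ^ (γ₂ + 1)))
    (hF : IsProbabilityMeasure (edgeLaw f₁ f₂)) (hμ : μ ∈ admissible γ₁ γ₂) {ρ s : ℝ}
    (hρ : 0 < ρ) (hs : 0 < s) :
    Integrable (fun p : (ℝ × ℝ) × (ℝ × ℝ) =>
      (scaledDensity γ₁ f₁ ρ p.2.1 * scaledDensity γ₂ f₂ ρ p.2.2) •
        expRemainder s (μ (box p.1 p.2))) refMeasure := by
  have hs₁ := measurable_scaledDensity (γ := γ₁) hf₁m ρ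
  have hs₂ := measurable_scaledDensity (γ := γ₂) hf₂m ρ
  obtain ⟨hi₁, hi₂⟩ := lintegral_edgeDensity_ne_top hf₁m hf₂m hf₁0 hF
  obtain ⟨T₁, hT₁, hfT₁⟩ := exists_tail_bound hf₁
  obtain ⟨T₂, hT₂, hfT₂⟩ := exists_tail_bound hf₂
  obtain ⟨C, α₁, α₂, hC, hα₁, hα₂, h⟩ := exists_lintegral_sq_box_le hμ
  refine ⟨(measurable_smul_expRemainder hf₁m hf₂m ρ s).aestronglyMeasurable, ?_⟩
  refine (lintegral_mono_ae (ae_refMeasure.mono fun p hp =>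
    enorm_smul_expRemainder_le hf₁0 hf₂0 hρ hs hp)).trans_lt ?_
  rw [lintegral_const_mul' _ _ (by simp)]
  refine ENNReal.mul_lt_top (by simp) ((h (fun t => ENNReal.ofReal (scaledDensity γ₁ f₁ ρ t))
    (fun t => ENNReal.ofReal (scaledDensity γ₂ f₂ ρ t)) (by fun_prop) (by fun_prop)).trans_lt
    (ENNReal.mul_lt_top hC.lt_top (ENNReal.mul_lt_top ?_ ?_)))
  · exact (lintegral_min_scaledDensity_le (by linarith) hT₁ hf₁m hfT₁ hρ).trans_lt
      (ENNReal.add_lt_top.2 ⟨ENNReal.mul_lt_top ENNReal.ofReal_lt_top hi₁.lt_top,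
        ENNReal.mul_lt_top (by simp) (lintegral_min_rpow_ne_top hγ₁ hα₁).lt_top⟩)
  · exact (lintegral_min_scaledDensity_le (by linarith) hT₂ hf₂m hfT₂ hρ).trans_lt
      (ENNReal.add_lt_top.2 ⟨ENNReal.mul_lt_top ENNReal.ofReal_lt_top hi₂.lt_top,
        ENNReal.mul_lt_top (by simp) (lintegral_min_rpow_ne_top hγ₂ hα₂).lt_top⟩)

/-- The contribution of boxes with large edges converges, by dominated convergence. -/
lemma tendsto_integral_largeEdges [l.IsCountablyGenerated] (hγ₁ : 1 < γ₁) (hγ₂ : 1 < γ₂)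
    (hf₁m : Measurable f₁)
    (hf₂m : Measurable f₂) (hf₁0 : ∀ t, 0 < t → 0 ≤ f₁ t) (hf₂0 : ∀ t, 0 < t → 0 ≤ f₂ t)
    (hf₁ : Asymptotics.IsEquivalent atTop f₁ (fun t => 1 / t ^ (γ₁ + 1)))
    (hf₂ : Asymptotics.IsEquivalent atTop f₂ (fun t => 1 / t ^ (γ₂ + 1)))
    (hμ : μ ∈ admissible γ₁ γ₂) {T : ℝ} (hT : 1 ≤ T)
    (hfT₁ : ∀ t, T ≤ t → f₁ t ≤ 2 * (1 / t ^ (γ₁ + 1)))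
    (hfT₂ : ∀ t, T ≤ t → f₂ t ≤ 2 * (1 / t ^ (γ₂ + 1)))
    (hr0 : ∀ i, 0 < r i) (hr : Tendsto r l (𝓝 0)) (hσ0 : ∀ i, 0 < σ i) (hσ : Tendsto σ l atTop) :
    Tendsto (fun i => ∫ p in largeEdges (r i * T),
        (scaledDensity γ₁ f₁ (r i) p.2.1 * scaledDensity γ₂ f₂ (r i) p.2.2) •
          expRemainder (σ i) (μ (box p.1 p.2)) ∂refMeasure) l
      (𝓝 (-(1 / 2) * ((∫ p, covIntegrand γ₁ γ₂ μ μ p ∂refMeasure : ℝ) : ℂ))) := by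
  have hrw : Tendsto r l (𝓝[>] 0) :=
    tendsto_nhdsWithin_iff.2 ⟨hr, Eventually.of_forall hr0⟩
  have hrT : Tendsto (fun i => r i * T) l (𝓝 0) := by simpa using hr.mul_const T
  have hcoe : ((∫ p, covIntegrand γ₁ γ₂ μ μ p ∂refMeasure : ℝ) : ℂ)
      = ∫ p, ((covIntegrand γ₁ γ₂ μ μ p : ℝ) : ℂ) ∂refMeasure := integral_ofReal.symm
  rw [hcoe, ← integral_const_mul]
  simp_rw [← integral_indicator (measurableSet_largeEdges _)]
  refine tendsto_integral_filter_of_dominated_convergence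
    -- 8 = 2 · 2 · 2: one factor for each density tail and one for the exponential remainder.
    (fun p => 8 * covIntegrand γ₁ γ₂ μ μ p)
    (Eventually.of_forall fun i => ((measurable_smul_expRemainder hf₁m hf₂m (r i)
      (σ i)).indicator (measurableSet_largeEdges _)).aestronglyMeasurable) ?_
    ((integrable_covIntegrand_self hγ₁ hγ₂ hμ).const_mul 8) ?_
  · refine Eventually.of_forall fun i => ?_
    filter_upwards [ae_refMeasure] with p hp
    have hp1 := hp.1
    have hp2 := hp.2
    have hcov : 0 ≤ covIntegrand γ₁ γ₂ μ μ p := by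
      rw [covIntegrand, ← sq]; positivity
    by_cases hpm : p ∈ largeEdges (r i * T)
    · rw [Set.indicator_of_mem hpm]
      have h1 := scaledDensity_nonneg (γ := γ₁) hf₁0 (hr0 i) hp.1
      have h2 := scaledDensity_nonneg (γ := γ₂) hf₂0 (hr0 i) hp.2
      rw [norm_smul, Real.norm_of_nonneg (mul_nonneg h1 h2)]
      calc _ ≤ (2 * (1 / p.2.1 ^ (γ₁ + 1))) * (2 * (1 / p.2.2 ^ (γ₂ + 1))) *
            (2 * μ (box p.1 p.2) ^ 2) := by
            gcongr
            · exact scaledDensity_le hT hfT₁ (hr0 i) hpm.1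
            · exact scaledDensity_le hT hfT₂ (hr0 i) hpm.2
            · exact norm_expRemainder_le (hσ0 i) _
        _ = _ := by rw [covIntegrand]; ring
    · rw [Set.indicator_of_notMem hpm, norm_zero]
      positivity
  · filter_upwards [ae_refMeasure] with p hp
    have h1 := ((tendsto_scaledDensity hf₁ hp.1).comp hrw).mul
      ((tendsto_scaledDensity hf₂ hp.2).comp hrw)
    have h2 := h1.smul ((tendsto_expRemainder (μ (box p.1 p.2))).comp hσ)
    have hval : (1 / p.2.1 ^ (γ₁ + 1) * (1 / p.2.2 ^ (γ₂ + 1))) •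
        (-(1 / 2) * ((μ (box p.1 p.2) : ℝ) : ℂ) ^ 2)
        = -(1 / 2) * ((covIntegrand γ₁ γ₂ μ μ p : ℝ) : ℂ) := by
      rw [covIntegrand, Complex.real_smul]
      push_cast
      ring
    rw [hval] at h2
    -- For fixed p the cutoff falls below both edge lengths eventually, so the indicator is finally
    -- 1.
    refine h2.congr' ?_
    filter_upwards [hrT.eventually (eventually_le_nhds hp.1),
      hrT.eventually (eventually_le_nhds hp.2)] with i hi1 hi2
    rw [Set.indicator_of_mem (show p ∈ largeEdges (r i * T) from ⟨hi1, hi2⟩)]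
    rfl

/-- The contribution of boxes with a small edge is negligible. -/
lemma tendsto_integral_compl_largeEdges (hγ₁ : 1 < γ₁) (hγ₂ : 1 < γ₂) (hf₁m : Measurable f₁)
    (hf₂m : Measurable f₂) (hf₁0 : ∀ t, 0 < t → 0 ≤ f₁ t) (hf₂0 : ∀ t, 0 < t → 0 ≤ f₂ t)
    (hF : IsProbabilityMeasure (edgeLaw f₁ f₂))
    (hμ : μ ∈ admissible γ₁ γ₂) {T : ℝ} (hT : 1 ≤ T)
    (hfT₁ : ∀ t, T ≤ t → f₁ t ≤ 2 * (1 / t ^ (γ₁ + 1)))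
    (hfT₂ : ∀ t, T ≤ t → f₂ t ≤ 2 * (1 / t ^ (γ₂ + 1)))
    (hr0 : ∀ i, 0 < r i) (hr : Tendsto r l (𝓝 0)) (hσ0 : ∀ i, 0 < σ i) :
    Tendsto (fun i => ∫ p in (largeEdges (r i * T))ᶜ,
        (scaledDensity γ₁ f₁ (r i) p.2.1 * scaledDensity γ₂ f₂ (r i) p.2.2) •
          expRemainder (σ i) (μ (box p.1 p.2)) ∂refMeasure) l (𝓝 0) := by
  obtain ⟨hi₁, hi₂⟩ := lintegral_edgeDensity_ne_top hf₁m hf₂m hf₁0 hF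
  obtain ⟨C, α₁, α₂, hC, hα₁, hα₂, h⟩ := exists_lintegral_sq_box_le hμ
  have hb := ((measurable_signedMeasure_box μ).pow_const 2).ennreal_ofReal
  set K₁ := ∫⁻ t in Set.Ioi 0, ENNReal.ofReal (min t (t ^ α₁)) *
    ENNReal.ofReal (1 / t ^ (γ₁ + 1)) with hK₁
  set K₂ := ∫⁻ t in Set.Ioi 0, ENNReal.ofReal (min t (t ^ α₂)) *
    ENNReal.ofReal (1 / t ^ (γ₂ + 1)) with hK₂
  have hK₁t : K₁ ≠ ∞ := lintegral_min_rpow_ne_top hγ₁ hα₁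
  have hK₂t : K₂ ≠ ∞ := lintegral_min_rpow_ne_top hγ₂ hα₂
  have hzero : ∀ {α γ : ℝ}, γ < α → ∀ c : ℝ≥0∞, c ≠ ∞ →
      Tendsto (fun i => ENNReal.ofReal (T ^ α * (r i) ^ (α - γ)) * c) l (𝓝 0) := by
    intro α γ hαγ c hc
    have h1 : Tendsto (fun i => (r i) ^ (α - γ)) l (𝓝 0) := by
      have := hr.rpow_const (p := α - γ) (Or.inr (by linarith))
      rwa [Real.zero_rpow (by linarith)] at this
    have h2 := ENNReal.tendsto_ofReal (h1.const_mul (T ^ α))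
    have h3 := ENNReal.Tendsto.mul_const h2 (b := c) (Or.inr hc)
    simpa using h3
  set S₁ : ι → ℝ≥0∞ := fun i => ENNReal.ofReal (T ^ α₁ * (r i) ^ (α₁ - γ₁)) *
    ∫⁻ t in Set.Ioi 0, ENNReal.ofReal (f₁ t) with hS₁
  set S₂ : ι → ℝ≥0∞ := fun i => ENNReal.ofReal (T ^ α₂ * (r i) ^ (α₂ - γ₂)) *
    ∫⁻ t in Set.Ioi 0, ENNReal.ofReal (f₂ t) with hS₂
  have hS₁0 : Tendsto S₁ l (𝓝 0) := hzero hα₁ _ hi₁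
  have hS₂0 : Tendsto S₂ l (𝓝 0) := hzero hα₂ _ hi₂
  -- In each product one factor tends to 0 and the other has a finite limit; finiteness matters
  -- because multiplication on `ℝ≥0∞` is not continuous at (0, ∞).
  have hlim : Tendsto (fun i => 2 * (C * (S₁ i * (S₂ i + 2 * K₂)) +
      C * ((S₁ i + 2 * K₁) * S₂ i))) l (𝓝 0) := by
    have hA₁ : Tendsto (fun i => S₁ i + 2 * K₁) l (𝓝 (0 + 2 * K₁)) :=
      hS₁0.add tendsto_const_nhds
    have hA₂ : Tendsto (fun i => S₂ i + 2 * K₂) l (𝓝 (0 + 2 * K₂)) :=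
      hS₂0.add tendsto_const_nhds
    have hk₁ : 0 + 2 * K₁ ≠ ∞ := by simpa using ENNReal.mul_ne_top (by simp) hK₁t
    have hk₂ : 0 + 2 * K₂ ≠ ∞ := by simpa using ENNReal.mul_ne_top (by simp) hK₂t
    have h1 := ENNReal.Tendsto.const_mul (a := C)
      (ENNReal.Tendsto.mul hS₁0 (Or.inr hk₂) hA₂ (Or.inr (by simp))) (Or.inr hC)
    have h2 := ENNReal.Tendsto.const_mul (a := C)
      (ENNReal.Tendsto.mul hA₁ (Or.inr (by simp)) hS₂0 (Or.inr hk₁)) (Or.inr hC)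
    have h3 := ENNReal.Tendsto.const_mul (a := 2) (h1.add h2) (Or.inr (by simp))
    simpa using h3
  rw [tendsto_zero_iff_enorm_tendsto_zero]
  refine tendsto_of_tendsto_of_tendsto_of_le_of_le tendsto_const_nhds hlim (fun _ => zero_le)
    fun i => ?_
  have hs₁ := measurable_scaledDensity (γ := γ₁) hf₁m (r i)
  have hs₂ := measurable_scaledDensity (γ := γ₂) hf₂m (r i)
  set φ : ℝ → ℝ≥0∞ := fun t => ENNReal.ofReal (scaledDensity γ₁ f₁ (r i) t) with hφ
  set ψ : ℝ → ℝ≥0∞ := fun t => ENNReal.ofReal (scaledDensity γ₂ f₂ (r i) t) with hψ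
  have hφm : Measurable φ := by fun_prop
  have hψm : Measurable ψ := by fun_prop
  set φ' := (Set.Iio (r i * T)).indicator φ with hφ'
  set ψ' := (Set.Iio (r i * T)).indicator ψ with hψ'
  have hφm' : Measurable φ' := hφm.indicator measurableSet_Iio
  have hψm' : Measurable ψ' := hψm.indicator measurableSet_Iio
  have hα₁0 : 0 ≤ α₁ := by linarith
  have hα₂0 : 0 ≤ α₂ := by linarith
  have hT0 : 0 ≤ T := by linarith
  -- Off `largeEdges` at least one edge is shorter than the cutoff; the mass is charged to the
  -- truncated density of that edge, with the other density left whole.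
  have hpt : ∀ᵐ p ∂refMeasure, (largeEdges (r i * T))ᶜ.indicator (fun p =>
      ‖(scaledDensity γ₁ f₁ (r i) p.2.1 * scaledDensity γ₂ f₂ (r i) p.2.2) •
          expRemainder (σ i) (μ (box p.1 p.2))‖ₑ) p
      ≤ 2 * (ENNReal.ofReal (μ (box p.1 p.2) ^ 2) * (φ' p.2.1 * ψ p.2.2) +
        ENNReal.ofReal (μ (box p.1 p.2) ^ 2) * (φ p.2.1 * ψ' p.2.2)) := by
    filter_upwards [ae_refMeasure] with p hp
    by_cases hpm : p ∈ largeEdges (r i * T)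
    · rw [Set.indicator_of_notMem (by simpa using hpm)]
      exact zero_le
    · rw [Set.indicator_of_mem (by simpa using hpm)]
      refine (enorm_smul_expRemainder_le hf₁0 hf₂0 (hr0 i) (hσ0 i) hp).trans ?_
      gcongr
      rcases lt_or_ge p.2.1 (r i * T) with h1 | h1
      · refine le_trans (le_of_eq ?_) le_self_add
        rw [hφ', Set.indicator_of_mem (Set.mem_Iio.2 h1)]
      · have h2 : p.2.2 < r i * T := not_le.1 fun h2 => hpm ⟨h1, h2⟩
        refine le_trans (le_of_eq ?_) le_add_self
        rw [hψ', Set.indicator_of_mem (Set.mem_Iio.2 h2)]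
  refine (enorm_integral_le_lintegral_enorm _).trans ?_
  rw [← lintegral_indicator (measurableSet_largeEdges _).compl]
  refine (lintegral_mono_ae hpt).trans ?_
  have hm : Measurable fun p : (ℝ × ℝ) × (ℝ × ℝ) =>
      ENNReal.ofReal (μ (box p.1 p.2) ^ 2) * (φ' p.2.1 * ψ p.2.2) := hb.mul (by fun_prop)
  rw [lintegral_const_mul' _ _ (by simp), lintegral_add_left hm]
  gcongr
  · refine (h φ' ψ hφm' hψm).trans ?_
    gcongr
    · exact lintegral_small_edges_le hα₁0 hT0 hf₁m (hr0 i)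
    · exact lintegral_min_scaledDensity_le hα₂0 hT hf₂m hfT₂ (hr0 i)
  · refine (h φ ψ' hφm hψm').trans ?_
    gcongr
    · exact lintegral_min_scaledDensity_le hα₁0 hT hf₁m hfT₁ (hr0 i)
    · exact lintegral_small_edges_le hα₂0 hT0 hf₂m (hr0 i)

/-- Convergence of the exponent of the characteristic function to that of the Gaussian limit. -/
theorem tendsto_integral_smul_expRemainder [l.IsCountablyGenerated] (hγ₁ : 1 < γ₁) (hγ₂ : 1 < γ₂)
    (hf₁m : Measurable f₁)
    (hf₂m : Measurable f₂) (hf₁0 : ∀ t, 0 < t → 0 ≤ f₁ t) (hf₂0 : ∀ t, 0 < t → 0 ≤ f₂ t)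
    (hf₁ : Asymptotics.IsEquivalent atTop f₁ (fun t => 1 / t ^ (γ₁ + 1)))
    (hf₂ : Asymptotics.IsEquivalent atTop f₂ (fun t => 1 / t ^ (γ₂ + 1)))
    (hF : IsProbabilityMeasure (edgeLaw f₁ f₂)) (hμ : μ ∈ admissible γ₁ γ₂)
    (hr0 : ∀ i, 0 < r i) (hr : Tendsto r l (𝓝 0)) (hσ0 : ∀ i, 0 < σ i) (hσ : Tendsto σ l atTop) :
    Tendsto (fun i => ∫ p,
        (scaledDensity γ₁ f₁ (r i) p.2.1 * scaledDensity γ₂ f₂ (r i) p.2.2) •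
          expRemainder (σ i) (μ (box p.1 p.2)) ∂refMeasure) l
      (𝓝 (-(1 / 2) * ((∫ p, covIntegrand γ₁ γ₂ μ μ p ∂refMeasure : ℝ) : ℂ))) := by
  obtain ⟨T₁, hT₁, hfT₁⟩ := exists_tail_bound hf₁
  obtain ⟨T₂, hT₂, hfT₂⟩ := exists_tail_bound hf₂
  have hT : 1 ≤ max T₁ T₂ := hT₁.trans (le_max_left _ _)
  have hfT₁' : ∀ t, max T₁ T₂ ≤ t → f₁ t ≤ 2 * (1 / t ^ (γ₁ + 1)) := fun t ht =>
    hfT₁ t ((le_max_left _ _).trans ht)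
  have hfT₂' : ∀ t, max T₁ T₂ ≤ t → f₂ t ≤ 2 * (1 / t ^ (γ₂ + 1)) := fun t ht =>
    hfT₂ t ((le_max_right _ _).trans ht)
  have h1 := tendsto_integral_largeEdges hγ₁ hγ₂ hf₁m hf₂m hf₁0 hf₂0 hf₁ hf₂ hμ hT hfT₁' hfT₂'
    hr0 hr hσ0 hσ
  have h2 := tendsto_integral_compl_largeEdges hγ₁ hγ₂ hf₁m hf₂m hf₁0 hf₂0 hF hμ hT hfT₁' hfT₂'
    hr0 hr hσ0
  have h3 := h1.add h2
  rw [add_zero] at h3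
  refine h3.congr fun i => ?_
  exact integral_add_compl (measurableSet_largeEdges _)
    (integrable_smul_expRemainder hγ₁ hγ₂ hf₁m hf₂m hf₁0 hf₂0 hf₁ hf₂ hF hμ (hr0 i) (hσ0 i))

end Limit

end RandomBoxes

namespace RandomBoxes

/-! ### The isonormal Gaussian process of a Hilbert space -/

section Isonormal

open scoped RealInnerProductSpace

variable {Ω : Type*} [MeasurableSpace Ω] {P : Measure Ω} [IsProbabilityMeasure P]

lemma integrable_cexp_mul_I {X : Ω → ℝ} (hX : AEStronglyMeasurable X P) :
    Integrable (fun ω => Complex.exp (X ω * Complex.I)) P := by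
  refine (integrable_const (1 : ℝ)).mono (by fun_prop) (Eventually.of_forall fun ω => ?_)
  simp [Complex.norm_exp_ofReal_mul_I]

/-- The functional is 1-Lipschitz, since t ↦ e^{it} is and the L¹ norm is at most the L² norm on a
probability space. -/
lemma continuous_integral_cexp_Lp :
    Continuous fun F : Lp ℝ 2 P => ∫ ω, Complex.exp (F ω * Complex.I) ∂P := by
  refine LipschitzWith.continuous (K := 1) (LipschitzWith.of_dist_le_mul fun F G => ?_)
  rw [dist_eq_norm, dist_eq_norm, NNReal.coe_one, one_mul,
    ← integral_sub (integrable_cexp_mul_I (Lp.aestronglyMeasurable F))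
      (integrable_cexp_mul_I (Lp.aestronglyMeasurable G)), Lp.norm_def]
  refine (ENNReal.toReal_le_toReal (by simp) (Lp.eLpNorm_ne_top _)).2 ?_ |>.trans' (le_of_eq
    (toReal_enorm _).symm)
  calc ‖∫ ω, (Complex.exp (F ω * Complex.I) - Complex.exp (G ω * Complex.I)) ∂P‖ₑ
      ≤ ∫⁻ ω, ‖Complex.exp (F ω * Complex.I) - Complex.exp (G ω * Complex.I)‖ₑ ∂P :=
        enorm_integral_le_lintegral_enorm _
    _ ≤ ∫⁻ ω, ‖(F - G : Lp ℝ 2 P) ω‖ₑ ∂P := by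
        refine lintegral_mono_ae ?_
        filter_upwards [Lp.coeFn_sub F G] with ω hω
        rw [hω, ← ofReal_norm, ← ofReal_norm]
        exact ENNReal.ofReal_le_ofReal (norm_cexp_mul_I_sub_le _ _)
    _ = eLpNorm (F - G : Lp ℝ 2 P) 1 P := eLpNorm_one_eq_lintegral_enorm.symm
    _ ≤ eLpNorm (F - G : Lp ℝ 2 P) 2 P :=
        eLpNorm_le_eLpNorm_of_exponent_le (by norm_num) (Lp.aestronglyMeasurable _)

/-- A linear isometry from a Hilbert space into an `L²` space that maps a Hilbert basis to
independent standard normal variables maps every vector to a centred normal variable. -/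
lemma map_eq_gaussianReal_of_hilbertBasis {H ι : Type*} [NormedAddCommGroup H]
    [InnerProductSpace ℝ H] (b : HilbertBasis ι ℝ H) (U : H →ₗᵢ[ℝ] Lp ℝ 2 P)
    (hind : iIndepFun (fun i => (U (b i) : Ω → ℝ)) P)
    (hlaw : ∀ i, P.map (U (b i)) = gaussianReal 0 1) (h : H) :
    P.map (U h) = gaussianReal 0 (‖h‖₊ ^ 2) := by
  -- On finite combinations of basis vectors independence factorizes the characteristic function;
  -- the expansion in the basis and continuity on both sides then reach every vector.
  have hsum : ∀ (s : Finset ι) (c : ι → ℝ),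
      ∫ ω, Complex.exp (U (∑ i ∈ s, c i • b i) ω * Complex.I) ∂P
        = Complex.exp (-((‖∑ i ∈ s, c i • b i‖ ^ 2 : ℝ) : ℂ) / 2) := by
    intro s c
    have h1 : (U (∑ i ∈ s, c i • b i) : Ω → ℝ) =ᵐ[P] fun ω => ∑ i ∈ s, c i * U (b i) ω := by
      rw [map_sum]
      have h2 : ∀ᵐ ω ∂P, ∀ i ∈ s, U (c i • b i) ω = c i * U (b i) ω := by
        rw [Filter.eventually_all_finset]
        intro i _
        rw [map_smul]
        filter_upwards [Lp.coeFn_smul (c i) (U (b i))] with ω hω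
        rw [hω]
        rfl
      filter_upwards [Lp.coeFn_finsetSum s fun i => U (c i • b i), h2] with ω hω h3
      rw [hω, Finset.sum_apply]
      exact Finset.sum_congr rfl h3
    have h2 : ∀ᵐ ω ∂P, Complex.exp (U (∑ i ∈ s, c i • b i) ω * Complex.I)
        = ∏ i : s, Complex.exp ((c i * U (b i) ω : ℝ) * Complex.I) := by
      filter_upwards [h1] with ω hω
      rw [hω, ← Complex.exp_sum, ← Finset.sum_mul, ← Complex.ofReal_sum,
        Finset.sum_coe_sort s fun i => c i * U (b i) ω]
    have hind' : iIndepFun (fun (i : s) => (U (b i) : Ω → ℝ)) P :=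
      hind.precomp Subtype.val_injective
    have h3 := hind'.integral_fun_prod_comp (𝕜 := ℂ)
      (f := fun (i : s) (x : ℝ) => Complex.exp ((c i * x : ℝ) * Complex.I))
      (fun i => (Lp.aestronglyMeasurable _).aemeasurable)
      (fun i => Measurable.aestronglyMeasurable (by fun_prop))
    have h4 : ∀ i : s, ∫ ω, Complex.exp ((c i * U (b i) ω : ℝ) * Complex.I) ∂P
        = Complex.exp (-((c i ^ 2 : ℝ) : ℂ) / 2) := by
      intro i
      have h5 := charFun_gaussianReal (μ := 0) (v := 1) (c i)
      rw [← hlaw i, charFun_apply_real, integral_map (Lp.aestronglyMeasurable _).aemeasurable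
        (Measurable.aestronglyMeasurable (by fun_prop))] at h5
      simp only [Complex.ofReal_mul]
      rw [h5]
      congr 1
      push_cast
      ring
    rw [integral_congr_ae h2, h3]
    simp_rw [h4]
    rw [← Complex.exp_sum, Finset.sum_coe_sort s fun i => -((c i ^ 2 : ℝ) : ℂ) / 2,
      ← real_inner_self_eq_norm_sq, b.orthonormal.inner_sum]
    congr 1
    push_cast
    rw [neg_div, Finset.sum_div, ← Finset.sum_neg_distrib]
    refine Finset.sum_congr rfl fun i _ => ?_
    simp [sq, neg_div]
  have hchar : ∀ g : H, ∫ ω, Complex.exp (U g ω * Complex.I) ∂P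
      = Complex.exp (-((‖g‖ ^ 2 : ℝ) : ℂ) / 2) := by
    intro g
    have hg := b.hasSum_repr g
    have hL := ((continuous_integral_cexp_Lp (P := P)).comp U.continuous).tendsto g |>.comp hg
    have hR : Continuous fun g : H => Complex.exp (-((‖g‖ ^ 2 : ℝ) : ℂ) / 2) := by fun_prop
    refine tendsto_nhds_unique hL (((hR.tendsto g).comp hg).congr fun s => ?_)
    exact (hsum s fun i => b.repr g i).symm
  have hm : AEMeasurable (U h) P := (Lp.aestronglyMeasurable _).aemeasurable
  have : IsProbabilityMeasure (P.map (U h)) := Measure.isProbabilityMeasure_map hm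
  refine Measure.ext_of_charFun ?_
  ext t
  rw [charFun_apply_real, integral_map hm (Measurable.aestronglyMeasurable (by fun_prop)),
    charFun_gaussianReal]
  -- The argument t is absorbed into the vector, so the value at 1 determines the whole
  -- characteristic function.
  have h6 : ∀ᵐ ω ∂P, Complex.exp (t * U h ω * Complex.I)
      = Complex.exp (U (t • h) ω * Complex.I) := by
    rw [map_smul]
    filter_upwards [Lp.coeFn_smul t (U h)] with ω hω
    rw [hω]
    simp
  rw [integral_congr_ae h6, hchar]
  congr 1
  rw [norm_smul, mul_pow, Real.norm_eq_abs, sq_abs]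
  push_cast
  ring

/-- Coordinates on a product of standard normal laws are centred, of variance 1 and independent,
hence orthonormal in L². -/
lemma orthonormal_eval_gaussian (ι : Type*) :
    ∃ ξ : ι → Lp ℝ 2 (Measure.infinitePi fun _ : ι => gaussianReal 0 1), Orthonormal ℝ ξ ∧
      ∀ i, ξ i =ᵐ[Measure.infinitePi fun _ : ι => gaussianReal 0 1] fun ω => ω i := by
  classical
  set P := Measure.infinitePi fun _ : ι => gaussianReal 0 1 with hP
  have hmp : ∀ i, MeasurePreserving (Function.eval i) P (gaussianReal 0 1) := fun i =>
    measurePreserving_eval_infinitePi _ i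
  have hL : ∀ i, MemLp (fun ω : ι → ℝ => ω i) 2 P := fun i =>
    (memLp_id_gaussianReal (μ := 0) (v := 1) 2).comp_measurePreserving (hmp i)
  have hind : iIndepFun (fun (i : ι) (ω : ι → ℝ) => ω i) P :=
    iIndepFun_infinitePi (X := fun _ x => x) fun _ => measurable_id
  have hmean : ∀ i, ∫ ω, ω i ∂P = 0 := fun i => by
    have := integral_map (hmp i).measurable.aemeasurable
      (f := fun x : ℝ => x) (by fun_prop) (μ := P)
    rw [(hmp i).map_eq, integral_id_gaussianReal] at this
    exact this.symm
  refine ⟨fun i => (hL i).toLp, orthonormal_iff_ite.2 fun i j => ?_, fun i => (hL i).coeFn_toLp⟩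
  have hin : ⟪(hL i).toLp, (hL j).toLp⟫ = ∫ ω, ω i * ω j ∂P := by
    rw [L2.inner_def]
    refine integral_congr_ae ?_
    filter_upwards [(hL i).coeFn_toLp, (hL j).coeFn_toLp] with ω h1 h2
    rw [h1, h2]
    simp [mul_comm]
  have hcov := covariance_eq_sub (hL i) (hL j)
  rw [hmean, zero_mul, sub_zero] at hcov
  rw [hin]
  refine Eq.trans hcov.symm ?_
  split_ifs with hij
  · subst hij
    rw [covariance_self (hL i).aestronglyMeasurable.aemeasurable]
    have := variance_map (X := fun x : ℝ => x) (Y := Function.eval i) (μ := P) (by fun_prop)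
      (hmp i).measurable.aemeasurable
    rw [(hmp i).map_eq] at this
    have h1 : Var[fun x : ℝ => x; gaussianReal 0 1] = 1 := by
      exact variance_id_gaussianReal (μ := 0) (v := 1)
    rw [h1] at this
    exact this.symm
  · exact (hind.indepFun hij).covariance_eq_zero (hL i) (hL j)

/-- Every real Hilbert space carries an isonormal Gaussian process. -/
theorem exists_isonormal (H : Type) [NormedAddCommGroup H] [InnerProductSpace ℝ H]
    [CompleteSpace H] :
    ∃ (Ω : Type) (_ : MeasurableSpace Ω) (P : Measure Ω) (_ : IsProbabilityMeasure P)
      (U : H →ₗᵢ[ℝ] Lp ℝ 2 P), ∀ h, P.map (U h) = gaussianReal 0 (‖h‖₊ ^ 2) := by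
  classical
  obtain ⟨w, b, -⟩ := exists_hilbertBasis ℝ H
  obtain ⟨P, hP⟩ : ∃ P, P = Measure.infinitePi fun _ : w => gaussianReal 0 1 := ⟨_, rfl⟩
  have : IsProbabilityMeasure P := by rw [hP]; infer_instance
  have hex := orthonormal_eval_gaussian w
  rw [← hP] at hex
  obtain ⟨ξ, hξ, hξe⟩ := hex
  -- Basis coordinates followed by c ↦ Σ cᵢ ξᵢ, an isometry on ℓ² because the ξᵢ are orthonormal.
  set U : H →ₗᵢ[ℝ] Lp ℝ 2 P :=
    hξ.orthogonalFamily.linearIsometry.comp b.repr.toLinearIsometry with hU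
  have hUb : ∀ i, U (b i) = ξ i := fun i => by
    rw [hU, LinearIsometry.coe_comp, Function.comp_apply, LinearIsometryEquiv.coe_toLinearIsometry, b.repr_self,
      OrthogonalFamily.linearIsometry_apply_single]
    simp
  have hind : iIndepFun (fun (i : w) (ω : w → ℝ) => ω i) P := by
    rw [hP]
    exact iIndepFun_infinitePi (X := fun _ x => x) fun _ => measurable_id
  refine ⟨w → ℝ, inferInstance, P, inferInstance, U, map_eq_gaussianReal_of_hilbertBasis b U ?_ ?_⟩
  · refine hind.congr fun i => ?_
    rw [hUb]
    exact (hξe i).symm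
  · intro i
    rw [hUb, Measure.map_congr (hξe i), hP]
    exact (measurePreserving_eval_infinitePi (fun _ : w => gaussianReal 0 1) i).map_eq

end Isonormal

/-- By linearity of U, a linear functional L of a finite marginal is U at the vector Σ L(e_h) h,
hence normal; normality of all such functionals is joint Gaussianity. -/
lemma isGaussianProcess_of_linearIsometry {Ω : Type*} [MeasurableSpace Ω] {P : Measure Ω}
    {H : Type*} [NormedAddCommGroup H]
    [InnerProductSpace ℝ H] (U : H →ₗᵢ[ℝ] Lp ℝ 2 P)
    (hU : ∀ h, P.map (U h) = gaussianReal 0 (‖h‖₊ ^ 2)) :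
    IsGaussianProcess (fun (h : H) ω => U h ω) P where
  hasGaussianLaw I := by
    classical
    have hm : AEMeasurable (fun ω => I.restrict fun h => U h ω) P :=
      aemeasurable_pi_lambda _ fun h => (Lp.aestronglyMeasurable _).aemeasurable
    refine ⟨isGaussian_of_map_eq_gaussianReal fun L =>
      ⟨0, ‖∑ h : I, L (Pi.single h 1) • (h : H)‖₊ ^ 2, ?_⟩⟩
    rw [AEMeasurable.map_map_of_aemeasurable (by fun_prop) hm, ← hU]
    refine Measure.map_congr ?_
    have h2 : ∀ᵐ ω ∂P, ∀ h : I, U (L (Pi.single h 1) • (h : H)) ω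
        = L (Pi.single h 1) * U (h : H) ω := by
      rw [ae_all_iff]
      intro h
      rw [map_smul]
      filter_upwards [Lp.coeFn_smul (L (Pi.single h 1)) (U (h : H))] with ω hω
      rw [hω]
      rfl
    have h3 := Lp.coeFn_finsetSum Finset.univ fun h : I => U (L (Pi.single h 1) • (h : H))
    rw [← map_sum] at h3
    filter_upwards [h2, h3] with ω h4 h5
    rw [h5, Finset.sum_apply, Function.comp_apply]
    simp_rw [h4]
    refine (LinearMap.pi_apply_eq_sum_univ L.toLinearMap _).trans ?_
    refine Finset.sum_congr rfl fun h _ => ?_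
    have h6 : (fun j : I => if h = j then (1 : ℝ) else 0) = Pi.single h 1 := by
      ext j
      simp [Pi.single_apply, eq_comm]
    rw [h6, smul_eq_mul, mul_comm]
    rfl


/-! ### The limiting field -/

/-- The element of `L²` that represents a signed measure. -/
noncomputable def covFeature (γ₁ γ₂ : ℝ) (μ : SignedMeasure (ℝ × ℝ))
    (p : (ℝ × ℝ) × (ℝ × ℝ)) : ℝ :=
  μ (box p.1 p.2) * √((1 / p.2.1 ^ (γ₁ + 1)) * (1 / p.2.2 ^ (γ₂ + 1)))

lemma covFeature_mul {γ₁ γ₂ : ℝ} (μ ν : SignedMeasure (ℝ × ℝ)) {p : (ℝ × ℝ) × (ℝ × ℝ)}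
    (hp : 0 < p.2.1 ∧ 0 < p.2.2) :
    covFeature γ₁ γ₂ μ p * covFeature γ₁ γ₂ ν p = covIntegrand γ₁ γ₂ μ ν p := by
  have hp1 := hp.1
  have hp2 := hp.2
  have h := Real.mul_self_sqrt
    (show 0 ≤ (1 / p.2.1 ^ (γ₁ + 1)) * (1 / p.2.2 ^ (γ₂ + 1)) by positivity)
  rw [covFeature, covFeature, covIntegrand]
  linear_combination (μ (box p.1 p.2) * ν (box p.1 p.2)) * h

lemma measurable_covFeature (γ₁ γ₂ : ℝ) (μ : SignedMeasure (ℝ × ℝ)) :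
    Measurable (covFeature γ₁ γ₂ μ) :=
  (measurable_signedMeasure_box μ).mul (by fun_prop)

lemma memLp_covFeature {γ₁ γ₂ : ℝ} (hγ₁ : 1 < γ₁) (hγ₂ : 1 < γ₂)
    {μ : SignedMeasure (ℝ × ℝ)} (hμ : μ ∈ admissible γ₁ γ₂) :
    MemLp (covFeature γ₁ γ₂ μ) 2 refMeasure := by
  rw [memLp_two_iff_integrable_sq (measurable_covFeature _ _ _).aestronglyMeasurable]
  refine (integrable_covIntegrand_self hγ₁ hγ₂ hμ).congr ?_
  filter_upwards [ae_refMeasure] with p hp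
  rw [sq, covFeature_mul μ μ hp]

/-- Existence of the centred Gaussian linear field with the given covariance. -/
theorem exists_gaussianField {γ₁ γ₂ : ℝ} (hγ₁ : 1 < γ₁) (hγ₂ : 1 < γ₂) :
    ∃ (Ω' : Type) (_ : MeasurableSpace Ω') (P' : Measure Ω')
      (Z : admissible γ₁ γ₂ → Ω' → ℝ), IsProbabilityMeasure P' ∧
      IsCentredGaussianLinearField P' (admissible γ₁ γ₂)
        (fun μ ν => ∫ p, covIntegrand γ₁ γ₂ μ ν p ∂refMeasure) Z := by
  obtain ⟨Ω', _, P', hP', U, hU⟩ := exists_isonormal (Lp ℝ 2 refMeasure)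
  have hL : ∀ μ : admissible γ₁ γ₂, MemLp (covFeature γ₁ γ₂ μ) 2 refMeasure := fun μ =>
    memLp_covFeature hγ₁ hγ₂ μ.2
  have hmean : ∀ h, ∫ ω, U h ω ∂P' = 0 := fun h => by
    have := integral_map (Lp.aestronglyMeasurable (U h)).aemeasurable
      (f := fun x : ℝ => x) (by fun_prop) (μ := P')
    rw [hU, integral_id_gaussianReal] at this
    exact this.symm
  refine ⟨Ω', _, P', fun μ ω => U (hL μ).toLp ω, hP', ?_, fun μ => hmean _, fun μ ν => ?_,
    fun a b μ ν κ hκ => ?_⟩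
  · exact (isGaussianProcess_of_linearIsometry U hU).comp_right fun μ => (hL μ).toLp
  · have h1 := covariance_eq_sub (Lp.memLp (U (hL μ).toLp)) (Lp.memLp (U (hL ν).toLp))
    rw [hmean, zero_mul, sub_zero] at h1
    refine h1.trans ?_
    have h2 := U.inner_map_map (hL μ).toLp (hL ν).toLp
    rw [L2.inner_def, L2.inner_def] at h2
    have h3 : ∫ ω, ((U (hL μ).toLp : Ω' → ℝ) * (U (hL ν).toLp : Ω' → ℝ)) ω ∂P'
        = ∫ ω, inner ℝ (U (hL μ).toLp ω) (U (hL ν).toLp ω) ∂P' :=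
      integral_congr_ae (Eventually.of_forall fun ω => by simp [mul_comm])
    rw [h3, h2]
    refine integral_congr_ae ?_
    filter_upwards [(hL μ).coeFn_toLp, (hL ν).coeFn_toLp, ae_refMeasure] with p h4 h5 hp
    rw [h4, h5, ← covFeature_mul _ _ hp]
    simp [mul_comm]
  · have h1 : (hL κ).toLp = a • (hL μ).toLp + b • (hL ν).toLp := by
      rw [← MemLp.toLp_const_smul, ← MemLp.toLp_const_smul, ← MemLp.toLp_add]
      refine MemLp.toLp_congr _ _ (Eventually.of_forall fun p => ?_)
      simp only [covFeature, hκ, Pi.add_apply, Pi.smul_apply, smul_eq_mul, _root_.add_apply,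
        _root_.smul_apply]
      ring
    rw [h1, map_add, map_smul, map_smul]
    filter_upwards [Lp.coeFn_add (a • U (hL μ).toLp) (b • U (hL ν).toLp),
      Lp.coeFn_smul a (U (hL μ).toLp), Lp.coeFn_smul b (U (hL ν).toLp)] with ω h2 h3 h4
    rw [h2, Pi.add_apply, h3, h4]
    rfl

end RandomBoxes

namespace RandomBoxes

/-! ### Linear combinations of admissible measures -/

/-- Below 1 powers decrease in the exponent; above 1 the right side is t. Lowering an exponent thus
weakens the admissibility bound, so two measures can share exponents. -/
lemma min_rpow_le_min_rpow {t α β : ℝ} (ht : 0 < t) (hα : 1 ≤ α) (hαβ : α ≤ β) :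
    min t (t ^ β) ≤ min t (t ^ α) := by
  rcases le_total t 1 with h | h
  · exact min_le_min_left _ (Real.rpow_le_rpow_of_exponent_ge ht h hαβ)
  · rw [min_eq_left (Real.self_le_rpow_of_one_le h hα)]
    exact min_le_left _ _

lemma zero_mem_admissible {γ₁ γ₂ : ℝ} (hγ₁ : γ₁ < 2) (hγ₂ : γ₂ < 2) :
    (0 : SignedMeasure (ℝ × ℝ)) ∈ admissible γ₁ γ₂ :=
  ⟨1, 2, 2, one_pos, hγ₁, le_rfl, hγ₂, le_rfl, fun u _ => by simp⟩

/-- From (ax + y)² ≤ 2a²x² + 2y², with the smaller exponent in each coordinate, which still exceeds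
γᵢ. -/
lemma smul_add_mem_admissible {γ₁ γ₂ : ℝ} (hγ₁ : 1 < γ₁) (hγ₂ : 1 < γ₂)
    {μ ν : SignedMeasure (ℝ × ℝ)} (hμ : μ ∈ admissible γ₁ γ₂) (hν : ν ∈ admissible γ₁ γ₂) (a : ℝ) :
    a • μ + ν ∈ admissible γ₁ γ₂ := by
  obtain ⟨C, α₁, α₂, hC, h1, h1', h2, h2', h⟩ := hμ
  obtain ⟨D, β₁, β₂, hD, g1, g1', g2, g2', g⟩ := hν
  refine ⟨2 * a ^ 2 * C + 2 * D, min α₁ β₁, min α₂ β₂, by positivity, lt_min h1 g1,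
    (min_le_left _ _).trans h1', lt_min h2 g2, (min_le_left _ _).trans h2', fun u hu => ?_⟩
  have hu1 : 0 < u.1 := hu.1
  have hu2 : 0 < u.2 := hu.2
  have hm : ∀ κ : SignedMeasure (ℝ × ℝ), Measurable fun x => ENNReal.ofReal (κ (box x u) ^ 2) :=
    fun κ => (((measurable_signedMeasure_box κ).comp
      (measurable_id.prodMk measurable_const)).pow_const 2).ennreal_ofReal
  set A := min u.1 (u.1 ^ min α₁ β₁) with hA
  set B := min u.2 (u.2 ^ min α₂ β₂) with hB
  have hA0 : 0 ≤ A := le_min hu1.le (Real.rpow_nonneg hu1.le _)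
  have hB0 : 0 ≤ B := le_min hu2.le (Real.rpow_nonneg hu2.le _)
  have hbound : ∀ {c e₁ e₂ : ℝ}, 0 < c → min α₁ β₁ ≤ e₁ → min α₂ β₂ ≤ e₂ →
      c * min u.1 (u.1 ^ e₁) * min u.2 (u.2 ^ e₂) ≤ c * A * B := by
    intro c e₁ e₂ hc he₁ he₂
    have i1 : min u.1 (u.1 ^ e₁) ≤ A :=
      min_rpow_le_min_rpow hu1 (hγ₁.le.trans (lt_min h1 g1).le) he₁
    have i2 : min u.2 (u.2 ^ e₂) ≤ B :=
      min_rpow_le_min_rpow hu2 (hγ₂.le.trans (lt_min h2 g2).le) he₂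
    have i3 : 0 ≤ min u.2 (u.2 ^ e₂) := le_min hu2.le (Real.rpow_nonneg hu2.le _)
    gcongr
  calc ∫⁻ x, ENNReal.ofReal ((a • μ + ν) (box x u) ^ 2)
      ≤ ∫⁻ x, (ENNReal.ofReal (2 * a ^ 2) * ENNReal.ofReal (μ (box x u) ^ 2) +
          ENNReal.ofReal 2 * ENNReal.ofReal (ν (box x u) ^ 2)) := by
        refine lintegral_mono fun x => ?_
        rw [← ENNReal.ofReal_mul (by positivity), ← ENNReal.ofReal_mul zero_le_two,
          ← ENNReal.ofReal_add (by positivity) (by positivity)]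
        refine ENNReal.ofReal_le_ofReal ?_
        simp only [_root_.add_apply, _root_.smul_apply, smul_eq_mul]
        nlinarith [sq_nonneg (a * μ (box x u) - ν (box x u))]
    _ = ENNReal.ofReal (2 * a ^ 2) * (∫⁻ x, ENNReal.ofReal (μ (box x u) ^ 2)) +
          ENNReal.ofReal 2 * ∫⁻ x, ENNReal.ofReal (ν (box x u) ^ 2) := by
        rw [lintegral_add_left ((hm μ).const_mul _), lintegral_const_mul _ (hm μ),
          lintegral_const_mul _ (hm ν)]
    _ ≤ ENNReal.ofReal (2 * a ^ 2) * ENNReal.ofReal (C * A * B) +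
          ENNReal.ofReal 2 * ENNReal.ofReal (D * A * B) := by
        gcongr
        · exact (h u hu).trans (ENNReal.ofReal_le_ofReal
            (hbound hC (min_le_left _ _) (min_le_left _ _)))
        · exact (g u hu).trans (ENNReal.ofReal_le_ofReal
            (hbound hD (min_le_right _ _) (min_le_right _ _)))
    _ = ENNReal.ofReal ((2 * a ^ 2 * C + 2 * D) * A * B) := by
        rw [← ENNReal.ofReal_mul (by positivity), ← ENNReal.ofReal_mul zero_le_two,
          ← ENNReal.ofReal_add (by positivity) (by positivity)]
        congr 1
        ring

lemma sum_smul_mem_admissible {γ₁ γ₂ : ℝ} (hγ₁ : γ₁ ∈ Set.Ioo (1 : ℝ) 2)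
    (hγ₂ : γ₂ ∈ Set.Ioo (1 : ℝ) 2) {κ : Type*} (s : Finset κ) (t : κ → ℝ)
    (μ : κ → admissible γ₁ γ₂) :
    ∑ j ∈ s, t j • (μ j : SignedMeasure (ℝ × ℝ)) ∈ admissible γ₁ γ₂ := by
  classical
  induction s using Finset.induction_on with
  | empty => simpa using zero_mem_admissible hγ₁.2 hγ₂.2
  | insert j s hj ih =>
    rw [Finset.sum_insert hj]
    exact smul_add_mem_admissible hγ₁.1 hγ₂.1 (μ j).2 ih (t j)

lemma sum_smul_box {κ : Type*} (s : Finset κ) (t : κ → ℝ) (μ : κ → SignedMeasure (ℝ × ℝ))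
    (A : Set (ℝ × ℝ)) : (∑ j ∈ s, t j • μ j) A = ∑ j ∈ s, t j * μ j A := by
  classical
  induction s using Finset.induction_on with
  | empty => simp
  | insert j s hj ih =>
    rw [Finset.sum_insert hj, Finset.sum_insert hj, _root_.add_apply, ih, _root_.smul_apply,
      smul_eq_mul]

/-! ### Characteristic functions of the limiting field -/

section Field

variable {γ₁ γ₂ : ℝ} {Ω' : Type*} [MeasurableSpace Ω'] {P' : Measure Ω'}
  {K : SignedMeasure (ℝ × ℝ) → SignedMeasure (ℝ × ℝ) → ℝ} {Z : admissible γ₁ γ₂ → Ω' → ℝ}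

lemma IsCentredGaussianLinearField.ae_eq_sum (hZ : IsCentredGaussianLinearField P' _ K Z)
    (hγ₁ : γ₁ ∈ Set.Ioo (1 : ℝ) 2) (hγ₂ : γ₂ ∈ Set.Ioo (1 : ℝ) 2) {κ : Type*} (s : Finset κ)
    (t : κ → ℝ) (μ : κ → admissible γ₁ γ₂) :
    ∀ᵐ ω ∂P', Z ⟨_, sum_smul_mem_admissible hγ₁ hγ₂ s t μ⟩ ω = ∑ j ∈ s, t j * Z (μ j) ω := by
  classical
  induction s using Finset.induction_on with
  | empty =>
    have h := hZ.linear 0 0 ⟨0, zero_mem_admissible hγ₁.2 hγ₂.2⟩ ⟨0, zero_mem_admissible hγ₁.2 hγ₂.2⟩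
      ⟨_, sum_smul_mem_admissible hγ₁ hγ₂ ∅ t μ⟩ (by simp)
    simpa using h
  | insert j s hj ih =>
    have h := hZ.linear (t j) 1 (μ j) ⟨_, sum_smul_mem_admissible hγ₁ hγ₂ s t μ⟩
      ⟨_, sum_smul_mem_admissible hγ₁ hγ₂ (insert j s) t μ⟩ (by simp [Finset.sum_insert hj])
    filter_upwards [ih, h] with ω h1 h2
    rw [h2, h1, Finset.sum_insert hj, one_mul]

/-- Argument 1 suffices: coefficients are absorbed into the indexing measure by linearity of the
field. -/
lemma IsCentredGaussianLinearField.integral_cexp (hZ : IsCentredGaussianLinearField P' _ K Z)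
    (κ : admissible γ₁ γ₂) :
    ∫ ω, Complex.exp (Z κ ω * Complex.I) ∂P' = Complex.exp (-(1 / 2) * (K κ κ : ℂ)) := by
  have hg := hZ.gaussian.hasGaussianLaw_eval κ
  have hm := hg.aemeasurable
  have h1 := charFun_apply_real (μ := P'.map (Z κ)) 1
  rw [integral_map hm (Measurable.aestronglyMeasurable (by fun_prop)), hg.map_eq_gaussianReal,
    charFun_gaussianReal, hZ.centred, Real.coe_toNNReal _ (variance_nonneg _ _),
    ← covariance_self hm, hZ.covariance_eq] at h1
  simp only [Complex.ofReal_one, one_mul] at h1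
  rw [← h1]
  congr 1
  simp
  ring

end Field

/-! ### Convergence in distribution from characteristic functions -/

lemma charFun_map_toLp {κ : Type*} [Fintype κ] {Ω : Type*} [MeasurableSpace Ω] {Q : Measure Ω}
    {Y : Ω → κ → ℝ} (hY : AEMeasurable (fun ω => WithLp.toLp 2 (Y ω)) Q) (t : EuclideanSpace ℝ κ) :
    charFun (Q.map fun ω => WithLp.toLp 2 (Y ω)) t
      = ∫ ω, Complex.exp ((∑ j, t j * Y ω j : ℝ) * Complex.I) ∂Q := by
  rw [charFun_apply, integral_map hY (Measurable.aestronglyMeasurable (by fun_prop))]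
  simp [PiLp.inner_apply]

/-- Lévy's continuity theorem, applied along sequences after moving to `EuclideanSpace`, where the
inner product supplies the sums Σ tⱼYⱼ; the identity map back to the product is continuous. -/
lemma tendstoInDistribution_pi_of_tendsto_integral_cexp {ι : Type*} {l : Filter ι}
    [l.IsCountablyGenerated] {Ω : ι → Type*} [∀ i, MeasurableSpace (Ω i)]
    {P : (i : ι) → Measure (Ω i)} [∀ i, IsProbabilityMeasure (P i)]
    {Ω' : Type*} [MeasurableSpace Ω'] {P' : Measure Ω'} [IsProbabilityMeasure P']
    {κ : Type*} [Fintype κ] {X : (i : ι) → Ω i → κ → ℝ} {Z : Ω' → κ → ℝ}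
    (hX : ∀ i, AEMeasurable (X i) (P i)) (hZ : AEMeasurable Z P')
    (h : ∀ t : κ → ℝ, Tendsto
      (fun i => ∫ ω, Complex.exp ((∑ j, t j * X i ω j : ℝ) * Complex.I) ∂(P i)) l
      (𝓝 (∫ ω, Complex.exp ((∑ j, t j * Z ω j : ℝ) * Complex.I) ∂P'))) :
    TendstoInDistribution X l Z P P' := by
  have hc : Continuous (WithLp.toLp 2 : (κ → ℝ) → EuclideanSpace ℝ κ) := PiLp.continuous_toLp 2 _
  have hXm : ∀ i, AEMeasurable (fun ω => WithLp.toLp 2 (X i ω)) (P i) := fun i =>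
    hc.measurable.comp_aemeasurable (hX i)
  have hZm : AEMeasurable (fun ω => WithLp.toLp 2 (Z ω)) P' := hc.measurable.comp_aemeasurable hZ
  have hE : TendstoInDistribution (fun i ω => WithLp.toLp 2 (X i ω)) l
      (fun ω => WithLp.toLp 2 (Z ω)) P P' := by
    refine ⟨hXm, hZm, tendsto_of_seq_tendsto fun x hx => ?_⟩
    refine ProbabilityMeasure.tendsto_iff_tendsto_charFun.2 fun t => ?_
    have h1 := (h t).comp hx
    simp only [ProbabilityMeasure.coe_mk]
    rw [charFun_map_toLp hZm]
    refine h1.congr fun m => ?_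
    exact (charFun_map_toLp (hXm (x m)) t).symm
  exact hE.continuous_comp (g := (WithLp.ofLp : EuclideanSpace ℝ κ → κ → ℝ))
    (PiLp.continuous_ofLp 2 _)

/-! ### Characteristic functions of the centred field -/

section Centred

variable {Ω : Type*} [MeasurableSpace Ω] {P : Measure Ω}
  {N : Ω → Measure ((ℝ × ℝ) × (ℝ × ℝ))} {n : Measure ((ℝ × ℝ) × (ℝ × ℝ))} [SigmaFinite n]

/-- Additivity of the integral requires all the integrals to converge, which holds only almost
surely; the expectations combine because every J(μⱼ) is integrable. -/
lemma ae_sum_centredJ_eq (hN : IsPoissonRandomMeasure N n P)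
    (hi : ∀ μ : SignedMeasure (ℝ × ℝ),
      Integrable (fun p : (ℝ × ℝ) × (ℝ × ℝ) => μ (box p.1 p.2)) n)
    {κ : Type*} [Fintype κ] (t : κ → ℝ) (μ : κ → SignedMeasure (ℝ × ℝ)) :
    ∀ᵐ ω ∂P, ∑ j, t j * centredJ P N (μ j) ω = centredJ P N (∑ j, t j • μ j) ω := by
  have hJ : ∀ᵐ ω ∂P, J N (∑ j, t j • μ j) ω = ∑ j, t j * J N (μ j) ω := by
    have h : ∀ᵐ ω ∂P, ∀ j, Integrable (fun p : (ℝ × ℝ) × (ℝ × ℝ) => μ j (box p.1 p.2)) (N ω) :=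
      ae_all_iff.2 fun j => hN.ae_integrable (measurable_signedMeasure_box _) (hi _)
    filter_upwards [h] with ω hω
    simp only [J, sum_smul_box]
    rw [integral_finsetSum _ fun j _ => (hω j).const_mul (t j)]
    simp_rw [integral_const_mul]
  have hJi : ∀ j, Integrable (J N (μ j)) P := fun j =>
    hN.integrable_integral (measurable_signedMeasure_box _) (hi (μ j))
  have hE : ∫ ω, J N (∑ j, t j • μ j) ω ∂P = ∑ j, t j * ∫ ω, J N (μ j) ω ∂P := by
    rw [integral_congr_ae hJ, integral_finsetSum _ fun j _ => (hJi j).const_mul (t j)]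
    simp_rw [integral_const_mul]
  filter_upwards [hJ] with ω hω
  simp only [centredJ]
  rw [hω, hE, ← Finset.sum_sub_distrib]
  exact Finset.sum_congr rfl fun j _ => mul_sub _ _ _

lemma integral_cexp_centredJ [IsProbabilityMeasure P] (hN : IsPoissonRandomMeasure N n P)
    (hi : ∀ μ : SignedMeasure (ℝ × ℝ),
      Integrable (fun p : (ℝ × ℝ) × (ℝ × ℝ) => μ (box p.1 p.2)) n)
    (c : ℝ) {κ : Type*} [Fintype κ] (t : κ → ℝ) (μ : κ → SignedMeasure (ℝ × ℝ)) :
    ∫ ω, Complex.exp ((∑ j, t j * (centredJ P N (μ j) ω / c) : ℝ) * Complex.I) ∂P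
      = Complex.exp (∫ p, (Complex.exp (((∑ j, t j • μ j) (box p.1 p.2) / c : ℝ) * Complex.I) - 1 -
          (((∑ j, t j • μ j) (box p.1 p.2) / c : ℝ) : ℂ) * Complex.I) ∂n) := by
  rw [← hN.integral_cexp_centred ((measurable_signedMeasure_box _).div_const c)
    ((hi _).div_const c)]
  refine integral_congr_ae ?_
  filter_upwards [ae_sum_centredJ_eq hN hi t μ] with ω hω
  simp only [integral_div]
  rw [← sub_div]
  change _ = Complex.exp ((centredJ P N (∑ j, t j • μ j) ω / c : ℝ) * Complex.I)
  rw [← hω, Finset.sum_div]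
  simp only [mul_div_assoc]

end Centred

end RandomBoxes

/-! ### The high intensity limit theorem. -/

theorem mainTheorem1
    (γ₁ γ₂ : ℝ) (hγ₁ : γ₁ ∈ Set.Ioo (1 : ℝ) 2) (hγ₂ : γ₂ ∈ Set.Ioo (1 : ℝ) 2)
    -- the law of the edge lengths
    (f₁ f₂ : ℝ → ℝ) (hf₁m : Measurable f₁) (hf₂m : Measurable f₂)
    (hf₁0 : ∀ t, 0 < t → 0 ≤ f₁ t) (hf₂0 : ∀ t, 0 < t → 0 ≤ f₂ t)
    (hf₁ : Asymptotics.IsEquivalent atTop f₁ (fun t => 1 / t ^ (γ₁ + 1)))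
    (hf₂ : Asymptotics.IsEquivalent atTop f₂ (fun t => 1 / t ^ (γ₂ + 1)))
    (hF : IsProbabilityMeasure (RandomBoxes.edgeLaw f₁ f₂))
    -- the intensity as a function of the scaling parameter `ρ > 0`
    (lam : Set.Ioi (0 : ℝ) → ℝ) (hlam : ∀ ρ, 0 < lam ρ)
    (hhigh : Tendsto (fun ρ : Set.Ioi (0 : ℝ) => lam ρ * (ρ : ℝ) ^ (γ₁ + γ₂))
      (comap (fun ρ : Set.Ioi (0 : ℝ) => (ρ : ℝ)) (𝓝 0)) atTop)
    -- the Poisson random measures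
    (Ω : Set.Ioi (0 : ℝ) → Type*) [∀ ρ, MeasurableSpace (Ω ρ)]
    (P : (ρ : Set.Ioi (0 : ℝ)) → Measure (Ω ρ)) [∀ ρ, IsProbabilityMeasure (P ρ)]
    (N : (ρ : Set.Ioi (0 : ℝ)) → Ω ρ → Measure ((ℝ × ℝ) × (ℝ × ℝ)))
    (hN : ∀ ρ, RandomBoxes.IsPoissonRandomMeasure (N ρ)
      (RandomBoxes.intensity (lam ρ)
        (RandomBoxes.scaledLaw (RandomBoxes.edgeLaw f₁ f₂) (ρ : ℝ))) (P ρ)) :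
    -- the random fields `J_ρ` are well defined and have finite expectation
    (∀ (ρ : Set.Ioi (0 : ℝ)) (μ : SignedMeasure (ℝ × ℝ)),
      (∀ᵐ ω ∂(P ρ), Integrable (fun p => μ (RandomBoxes.box p.1 p.2)) (N ρ ω)) ∧
      Integrable (RandomBoxes.J (N ρ) μ) (P ρ)) ∧
    -- the covariance integrals converge
    (∀ μ ∈ RandomBoxes.admissible γ₁ γ₂, ∀ ν ∈ RandomBoxes.admissible γ₁ γ₂,
      IntegrableOn (RandomBoxes.covIntegrand γ₁ γ₂ μ ν) (Set.univ ×ˢ RandomBoxes.posQuadrant)) ∧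
    -- the limiting field exists
    (∃ (Ω' : Type) (_ : MeasurableSpace Ω') (P' : Measure Ω')
      (Z : RandomBoxes.admissible γ₁ γ₂ → Ω' → ℝ), IsProbabilityMeasure P' ∧
      RandomBoxes.IsCentredGaussianLinearField P' (RandomBoxes.admissible γ₁ γ₂)
        (fun μ ν => ∫ p in Set.univ ×ˢ RandomBoxes.posQuadrant,
          RandomBoxes.covIntegrand γ₁ γ₂ μ ν p) Z) ∧
    -- convergence of the finite-dimensional distributions
    (∀ (Ω' : Type*) [MeasurableSpace Ω'] (P' : Measure Ω') [IsProbabilityMeasure P']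
      (Z : RandomBoxes.admissible γ₁ γ₂ → Ω' → ℝ),
      RandomBoxes.IsCentredGaussianLinearField P' (RandomBoxes.admissible γ₁ γ₂)
        (fun μ ν => ∫ p in Set.univ ×ˢ RandomBoxes.posQuadrant,
          RandomBoxes.covIntegrand γ₁ γ₂ μ ν p) Z →
      ∀ (k : ℕ) (μ : Fin k → RandomBoxes.admissible γ₁ γ₂),
        TendstoInDistribution
          (fun (ρ : Set.Ioi (0 : ℝ)) (ω : Ω ρ) (i : Fin k) =>
            RandomBoxes.centredJ (P ρ) (N ρ) (μ i) ω / √(lam ρ * (ρ : ℝ) ^ (γ₁ + γ₂)))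
          (comap (fun ρ : Set.Ioi (0 : ℝ) => (ρ : ℝ)) (𝓝 0))
          (fun (ω : Ω') (i : Fin k) => Z (μ i) ω) P P') := by
  have hint : ∀ (ρ : Set.Ioi (0 : ℝ)) (μ : SignedMeasure (ℝ × ℝ)),
      Integrable (fun p : (ℝ × ℝ) × (ℝ × ℝ) => μ (RandomBoxes.box p.1 p.2))
        (RandomBoxes.intensity (lam ρ)
          (RandomBoxes.scaledLaw (RandomBoxes.edgeLaw f₁ f₂) (ρ : ℝ))) := fun ρ μ =>
    RandomBoxes.integrable_box_intensity hγ₁.1 hγ₂.1 hf₁m hf₂m hf₁0 hf₁ hf₂ hF (lam ρ) ρ.2 μ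
  have hσf : ∀ ρ : Set.Ioi (0 : ℝ), SigmaFinite (RandomBoxes.intensity (lam ρ)
      (RandomBoxes.scaledLaw (RandomBoxes.edgeLaw f₁ f₂) (ρ : ℝ))) := fun ρ => by
    have := RandomBoxes.isProbabilityMeasure_scaledLaw hF (ρ : ℝ)
    exact RandomBoxes.sigmaFinite_intensity (lam ρ)
  refine ⟨fun ρ μ => ⟨?_, ?_⟩, fun μ hμ ν hν => ?_, ?_, ?_⟩
  · have := hσf ρ
    exact (hN ρ).ae_integrable (RandomBoxes.measurable_signedMeasure_box μ) (hint ρ μ)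
  · have := hσf ρ
    exact (hN ρ).integrable_integral (RandomBoxes.measurable_signedMeasure_box μ) (hint ρ μ)
  · exact RandomBoxes.integrable_covIntegrand hγ₁.1 hγ₂.1 hμ hν
  · exact RandomBoxes.exists_gaussianField hγ₁.1 hγ₂.1
  · intro Ω' _ P' _ Z hZ k μ
    refine RandomBoxes.tendstoInDistribution_pi_of_tendsto_integral_cexp (fun ρ => ?_) ?_
      fun t => ?_
    · have := hσf ρ
      refine aemeasurable_pi_lambda _ fun i => ?_
      have hJ := (hN ρ).aestronglyMeasurable_integral
        (RandomBoxes.measurable_signedMeasure_box (μ i : SignedMeasure (ℝ × ℝ))) (hint ρ (μ i))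
      exact (hJ.aemeasurable.sub_const _).div_const _
    · exact aemeasurable_pi_lambda _ fun i => hZ.gaussian.aemeasurable (μ i)
    -- Cramér–Wold: the coefficients t are merged into the single admissible measure Σ tⱼ μⱼ, on the
    -- Poisson side and in the limit.
    · have hmem := RandomBoxes.sum_smul_mem_admissible hγ₁ hγ₂ Finset.univ t μ
      have hlim : ∫ ω, Complex.exp ((∑ j, t j * Z (μ j) ω : ℝ) * Complex.I) ∂P'
          = Complex.exp (-(1 / 2) * ((∫ p in Set.univ ×ˢ RandomBoxes.posQuadrant, RandomBoxes.covIntegrand γ₁ γ₂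
              (∑ j, t j • (μ j : SignedMeasure (ℝ × ℝ))) (∑ j, t j • (μ j : SignedMeasure (ℝ × ℝ)))
              p : ℝ) : ℂ)) := by
        rw [← hZ.integral_cexp ⟨_, hmem⟩]
        refine integral_congr_ae ?_
        filter_upwards [hZ.ae_eq_sum hγ₁ hγ₂ Finset.univ t μ] with ω hω
        rw [hω]
      rw [hlim]
      have hr0 : ∀ ρ : Set.Ioi (0 : ℝ), 0 < (ρ : ℝ) := fun ρ => ρ.2
      have hpos : ∀ ρ : Set.Ioi (0 : ℝ), 0 < lam ρ * (ρ : ℝ) ^ (γ₁ + γ₂) := fun ρ =>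
        mul_pos (hlam ρ) (Real.rpow_pos_of_pos (hr0 ρ) _)
      have hexp := (Complex.continuous_exp.tendsto _).comp
        (RandomBoxes.tendsto_integral_smul_expRemainder hγ₁.1 hγ₂.1 hf₁m hf₂m hf₁0 hf₂0 hf₁ hf₂ hF
          hmem hr0 tendsto_comap hpos hhigh)
      refine hexp.congr fun ρ => ?_
      have := hσf ρ
      rw [RandomBoxes.integral_cexp_centredJ (hN ρ) (hint ρ) _ t
        fun j => (μ j : SignedMeasure (ℝ × ℝ)),
        RandomBoxes.integral_intensity_eq hf₁m hf₂m hf₁0 hf₂0 (hlam ρ) (hr0 ρ)]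
      rfl
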